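/- Let $n\ge 1$, and let $f:\mathbb{R}^n\to\mathbb{R}$, $g:\mathbb{R}^n\to\mathbb{R}^{n_g}$, $h:\mathbb{R}^n\to\mathbb{R}^{n_h}$ be continuously differentiable with Lipschitz continuous gradients. Let $C=\{x\in\mathbb{R}^n : g(x)\ge 0,\ h(x)=0\}$ be non-empty and bounded. For $x\in\mathbb{R}^n$ let $I_x=\{i : g_i(x)\le 0\}$, and assume that the Mangasarian–Fromovitz constraint qualification holds at every $x\in\mathbb{R}^n$: the vectors $\nabla h_j(x)$, $1\le j\le n_h$, are linearly independent, and there is $w\in\mathbb{R}^n$ with $\nabla h_j(x)^{\top}w=0$ for all $j$ and $\nabla g_i(x)^{\top}w>0$ for all $i\in I_x$. Assume convexity in the following sense: $h$ is affine and every $g_i$ is concave (so that $C$ is convex), and $f$ is strongly convex with constant $\mu>0$. For $\alpha>0$ define $$V_\alpha(x)=\{v\in\mathbb{R}^n : \nabla h(x)^{\top}v+\alpha h(x)=0,\ \nabla g_i(x)^{\top}v+\alpha g_i(x)\ge 0\ \ \forall i\in I_x\},$$ the Lagrangian $l(x,\lambda)=f(x)-\lambda_h^{\top}h(x)-\lambda_g^{\top}g(x)$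 for $\lambda=(\lambda_h,\lambda_g)\in\mathbb{R}^{n_h}\times\mathbb{R}^{n_g}$, the set $D_x=\{\lambda : \lambda_g\ge 0,\ (\lambda_g)_i=0\ \forall i\notin I_x\}$, and the dual function $$d(x)=\max_{\lambda\in D_x}\ l(x,\lambda)-\frac{1}{2\alpha}|\nabla_x l(x,\lambda)|^2 .$$ For each $x$ let $\lambda(x)$ be any maximizer in the definition of $d(x)$. Let $0<\alpha<\mu$, let $L_l$ be such that for every $x\in\mathbb{R}^n$ the gradient of $l(\cdot,\lambda(x))$ is Lipschitz continuous with constant $L_l$ (if $g$ is affine, $l(\cdot,\lambda)$ has, for every $\lambda$, the same smoothness constants as $f$), and let $0<T\le \frac{2}{L_l+\mu}$. Consider the scheme $$x_{k+1}=x_k-T\nabla f(x_k)+TR_k,\qquad -R_k\in\partial\psi_{V_\alpha(x_k)}\big((x_{k+1}-x_k)/T\big),\qquad k=0,1,2,\dots,$$ where $\psi_V$ is the indicator function of $V$ ($0$ on $V$, $\infty$ elsewhere) and $\partial$ the subdifferential. Then the maximum defining $d(x)$ is attained and $v\mapsto\frac12|v+\nabla f(x)|^2$ has a unique minimizer $v(x)$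 over $V_\alpha(x)$, for every $x$; for every $x_0\in\mathbb{R}^n$ there is exactly one pair of sequences $(x_k)$, $(R_k)$ that satisfies the scheme, and $(x_{k+1}-x_k)/T=-\nabla f(x_k)+R_k=v(x_k)$. The problem $\min_{x\in C}f(x)$ has a unique minimizer $x^*$; put $f^*=f(x^*)$. Let $$c_1=T\Big(\frac{\mu}{\alpha}-1\Big)\Big(1-\frac{\mu T}{2}\Big),\qquad c_2=\frac{2\alpha(1-\mu T/2)(\mu-\alpha)}{L_l-\alpha}.$$ Then $c_1>0$, $c_2>0$, $c_2T<1$, and for every $x_0\in\mathbb{R}^n$: $x_k\to x^*$; the sequence $d(x_k)$ is monotonically increasing and converges to $f^*$; the velocity $(x_{k+1}-x_k)/T$ converges to $0$; $$\min_{j\in\{0,\dots,k\}}|-\nabla f(x_j)+R_j|^2\le\frac{f^*-d(x_0)}{c_1(k+1)}\qquad\forall k\ge 0;$$ and there is an integer $N$ such that for all $k\ge N$ $$|-\nabla f(x_k)+R_k|^2\le\frac{2}{c_1}(1-c_2T)^{k-N}\,(f^*-d(x_N)),$$ $$\min_{j\in\{0,\dots,k\}}|x^*-x_j|^2\le\frac{L_l/\alpha-1}{c_1\,\alpha\,(\mu-\alpha)}\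 \frac{f^*-d(x_0)}{k+1},$$ $$|x^*-x_k|^2\le\frac{2(L_l/\alpha-1)}{c_1\,\alpha\,(\mu-\alpha)}(1-c_2T)^{k-N}\,(f^*-d(x_N)).$$ -/

import Mathlib

open Filter Topology

noncomputable section

/-- Euclidean `n`-space. -/
abbrev Euc (n : ℕ) := EuclideanSpace ℝ (Fin n)

/-- Multipliers `(lam_h, lam_g)` for `nh` equality and `ng` inequality constraints. -/
abbrev Mult (nh ng : ℕ) := (Fin nh → ℝ) × (Fin ng → ℝ)

/-- The data of the problem: minimize `f x` subject to `h j x = 0` and `g i x ≥ 0`. -/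
structure Problem (n nh ng : ℕ) where
  /-- objective -/
  f : Euc n → ℝ
  /-- equality constraints -/
  h : Fin nh → Euc n → ℝ
  /-- inequality constraints -/
  g : Fin ng → Euc n → ℝ

/-- `φ` is continuously differentiable and has a Lipschitz continuous gradient. -/
def LipGrad {n : ℕ} (φ : Euc n → ℝ) : Prop :=
  ContDiff ℝ 1 φ ∧ ∃ K : NNReal, LipschitzWith K (gradient φ)

/-- `φ` is smooth with constant `L`: its gradient is Lipschitz continuous with constant `L`. -/
def SmoothWith {n : ℕ} (L : ℝ) (φ : Euc n → ℝ) : Prop :=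
  ∀ x y, ‖gradient φ x - gradient φ y‖ ≤ L * ‖x - y‖

/-- The subdifferential at `v` of the indicator function of `S` (value `0` on `S` and `∞` off `S`);
it is empty when `v ∉ S`. -/
def subdiffIndicator {n : ℕ} (S : Set (Euc n)) (v : Euc n) : Set (Euc n) :=
  {p | v ∈ S ∧ ∀ y ∈ S, inner ℝ p (y - v) ≤ 0}

namespace Problem

variable {n nh ng : ℕ} (P : Problem n nh ng)

/-- The feasible set `C`. -/
def feasible : Set (Euc n) :=
  {x | (∀ i, 0 ≤ P.g i x) ∧ ∀ j, P.h j x = 0}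

/-- The active inequality constraints `I_x` (those with `g i x ≤ 0`, violated ones included). -/
def active (x : Euc n) : Set (Fin ng) := {i | P.g i x ≤ 0}

/-- The Mangasarian-Fromovitz constraint qualification at `x`. -/
def MFCQ (x : Euc n) : Prop :=
  LinearIndependent ℝ (fun j => gradient (P.h j) x) ∧
    ∃ w : Euc n, (∀ j, inner ℝ (gradient (P.h j) x) w = 0) ∧
      ∀ i ∈ P.active x, 0 < inner ℝ (gradient (P.g i) x) w

/-- The set `V_α(x)` of admissible velocities at `x`. -/
def V (α : ℝ) (x : Euc n) : Set (Euc n) :=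
  {v | (∀ j, inner ℝ (gradient (P.h j) x) v + α * P.h j x = 0) ∧
    ∀ i ∈ P.active x, 0 ≤ inner ℝ (gradient (P.g i) x) v + α * P.g i x}

/-- `v` minimizes `|v + ∇f(x)|² / 2` over `V_α(x)`, i.e. it is a projection of `-∇f(x)`. -/
def IsVelocity (α : ℝ) (x v : Euc n) : Prop :=
  v ∈ P.V α x ∧ IsMinOn (fun u => (1 / 2 : ℝ) * ‖u + gradient P.f x‖ ^ 2) (P.V α x) v

/-- The discrete scheme: `x (k+1) = x k - T ∇f(x k) + T R k` with
`-R k` in the subdifferential of the indicator of `V_α(x k)` at `(x (k+1) - x k) / T`. -/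
def IsRun (α T : ℝ) (x R : ℕ → Euc n) : Prop :=
  ∀ k, x (k + 1) = x k - T • gradient P.f (x k) + T • R k ∧
    -R k ∈ subdiffIndicator (P.V α (x k)) ((1 / T) • (x (k + 1) - x k))

/-- The Lagrangian `l(x, lam) = f(x) - lam_h ⬝ h(x) - lam_g ⬝ g(x)`. -/
def lagrangian (x : Euc n) (lam : Mult nh ng) : ℝ :=
  P.f x - (∑ j, lam.1 j * P.h j x + ∑ i, lam.2 i * P.g i x)

/-- The multiplier set `D_x`: multipliers of inequality constraints are nonnegative, and zero for
the inactive ones. -/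
def D (x : Euc n) : Set (Mult nh ng) :=
  {lam | (∀ i, 0 ≤ lam.2 i) ∧ ∀ i ∉ P.active x, lam.2 i = 0}

/-- The objective `l(x, lam) - |∇ₓ l(x, lam)|² / (2 α)` of the dual problem at `x`. -/
def dualObj (α : ℝ) (x : Euc n) (lam : Mult nh ng) : ℝ :=
  P.lagrangian x lam - 1 / (2 * α) * ‖gradient (fun y => P.lagrangian y lam) x‖ ^ 2

/-- `lam` attains the maximum of the dual objective over `D_x`. -/
def IsDualMaximizer (α : ℝ) (x : Euc n) (lam : Mult nh ng) : Prop :=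
  lam ∈ P.D x ∧ IsMaxOn (P.dualObj α x) (P.D x) lam

/-- The dual function `d(x)`, the maximum of the dual objective over `D_x`. -/
def d (α : ℝ) (x : Euc n) : ℝ := sSup (P.dualObj α x '' P.D x)

end Problem

/-- The constant `c₁ = T (μ/α - 1) (1 - μ T/2)`. -/
def cOne (μ α T : ℝ) : ℝ := T * (μ / α - 1) * (1 - μ * T / 2)

/-- The constant `c₂ = 2 α (1 - μ T/2) (μ - α) / (L - α)`. -/
def cTwo (μ α T L : ℝ) : ℝ := 2 * α * (1 - μ * T / 2) * (μ - α) / (L - α)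

end

/-! The dual function `d` is a Lyapunov function bounded above by `f xs`. The optimality conditions
of a dual maximizer `m` at `x` say that `v = -∇ₓ l(x, m)` lies in `V_α(x)` and is complementary to
`m`; hence `v` is the projection of `-∇f(x)` onto `V_α(x)`, and the scheme is the explicit Euler
step `x + T v`.

Ascent (`Regular.d_step`): if `m_i > 0`, complementarity and concavity give `g_i(x + T v) ≤ (1 - α
T) g_i(x) ≤ 0`, so `m` remains admissible at the next iterate. The step is a gradient step on the
strongly convex function `l(·, m)`, whose gradient it contracts by the factor `1 - μ T`; therefore
`d` grows by at least `c₁ |v|²`.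

Weak duality (`Regular.d_add_le`): for feasible `y`, `d(x) + (μ - α)/2 |y - x|² ≤ f(y)`. This bounds
the iterates and makes `|v_k|²` summable. Cluster points are then feasible, `d` tends to their
objective value along a subsequence, and that value must be `f xs`; the quadratic margin yields
convergence of the iterates.

Linear rate: compactness of the multipliers, a consequence of the constraint qualification, shows
that eventually some optimal multiplier is admissible at `x_k`. Testing its Lagrangian at `x_k +
v_k/α` bounds the duality gap by a multiple of `|v_k|²` (`Regular.gap_le`), and the ascent estimate
turns this into contraction by `1 - c₂ T`. -/

section FirstOrder

/-! ### First-order inequalities for convex and smooth functions -/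

variable {E : Type*} [NormedAddCommGroup E] [InnerProductSpace ℝ E]
  {φ : E → ℝ} {φ' : E → E} {μ L : ℝ}

/-- Cocoercivity of the gradient of a smooth convex function (Baillon-Haddad). -/
theorem cocoercive_of_bounds {M : ℝ} (hM : 0 ≤ M)
    (hlo : ∀ x y, φ x + inner ℝ (φ' x) (y - x) ≤ φ y)
    (hup : ∀ x y, φ y ≤ φ x + inner ℝ (φ' x) (y - x) + M / 2 * ‖y - x‖ ^ 2) (x y : E) :
    ‖φ' x - φ' y‖ ^ 2 ≤ M * inner ℝ (φ' x - φ' y) (x - y) := by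
  -- The point `x - t (φ' x - φ' y)` is bounded from below by the tangent plane at `y` and from
  -- above by the quadratic model at `x`.
  have key : ∀ (x y : E) (t : ℝ), φ y + inner ℝ (φ' y) (x - y) +
      (t - M / 2 * t ^ 2) * ‖φ' x - φ' y‖ ^ 2 ≤ φ x := fun x y t => by
    have h1 := hlo y (x - t • (φ' x - φ' y))
    have h2 := hup x (x - t • (φ' x - φ' y))
    have e1 : x - t • (φ' x - φ' y) - y = (x - y) - t • (φ' x - φ' y) := by abel
    have e2 : x - t • (φ' x - φ' y) - x = -(t • (φ' x - φ' y)) := by abel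
    have e3 : inner ℝ (φ' x) (φ' x - φ' y) - inner ℝ (φ' y) (φ' x - φ' y) =
        ‖φ' x - φ' y‖ ^ 2 := by
      rw [← inner_sub_left, real_inner_self_eq_norm_sq]
    rw [e1, inner_sub_right, inner_smul_right] at h1
    rw [e2, inner_neg_right, inner_smul_right, norm_neg, norm_smul, mul_pow, Real.norm_eq_abs,
      sq_abs] at h2
    linear_combination h1 + h2 - t * e3
  have key2 : ∀ t : ℝ, (2 * t - M * t ^ 2) * ‖φ' x - φ' y‖ ^ 2 ≤
      inner ℝ (φ' x - φ' y) (x - y) := fun t => by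
    have h1 := key x y t
    have h2 := key y x t
    rw [norm_sub_rev (φ' y), ← neg_sub x y, inner_neg_right] at h2
    rw [inner_sub_left]
    linarith
  rcases hM.eq_or_lt with rfl | hM
  · rw [zero_mul]
    by_contra! hlt
    -- For `M = 0` the parameter `t` is free; this value makes the left side twice `inner + 1`,
    -- which is too large because the inner product is nonnegative (`t = 0`).
    have h0 := key2 ((inner ℝ (φ' x - φ' y) (x - y) + 1) / ‖φ' x - φ' y‖ ^ 2)
    have h1 := key2 0
    rw [zero_mul, sub_zero, ← mul_div_assoc, div_mul_cancel₀ _ hlt.ne'] at h0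
    linarith
  -- `t = 1 / M` maximizes `2 t - M t²`.
  · have h := key2 (1 / M)
    have e : 2 * (1 / M) - M * (1 / M) ^ 2 = 1 / M := by field_simp; ring
    rw [e] at h
    calc ‖φ' x - φ' y‖ ^ 2 = M * (1 / M * ‖φ' x - φ' y‖ ^ 2) := by field_simp
      _ ≤ _ := mul_le_mul_of_nonneg_left h hM.le

/-- The smoothness constant is at least the strong convexity constant. -/
theorem strong_convexity_const_le [Nontrivial E]
    (hμ : ∀ x y, φ x + inner ℝ (φ' x) (y - x) + μ / 2 * ‖y - x‖ ^ 2 ≤ φ y)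
    (hL : ∀ x y, ‖φ' x - φ' y‖ ≤ L * ‖x - y‖) : μ ≤ L := by
  obtain ⟨x, y, hxy⟩ := exists_pair_ne E
  have h1 := hμ x y
  have h2 := hμ y x
  have h3 := (real_inner_le_norm (φ' x - φ' y) (x - y)).trans
    (mul_le_mul_of_nonneg_right (hL x y) (norm_nonneg _))
  rw [inner_sub_left] at h3
  rw [norm_sub_rev y x, ← neg_sub x y, inner_neg_right] at h1
  have hpos : 0 < ‖x - y‖ ^ 2 := pow_pos (norm_pos_iff.2 (sub_ne_zero.2 hxy)) 2
  refine le_of_mul_le_mul_right (?_ : μ * ‖x - y‖ ^ 2 ≤ L * ‖x - y‖ ^ 2) hpos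
  linarith

variable [CompleteSpace E]

theorem hasDerivAt_comp_line (hφ : ∀ x, HasGradientAt φ (φ' x) x) (x v : E) (t : ℝ) :
    HasDerivAt (fun s : ℝ => φ (x + s • v)) (inner ℝ (φ' (x + t • v)) v) t := by
  have h1 : HasDerivAt (fun s : ℝ => x + s • v) v t := by
    simpa using ((hasDerivAt_id t).smul_const v).const_add x
  have h2 := (hφ (x + t • v)).hasFDerivAt.comp_hasDerivAt t h1
  simpa [Function.comp_def] using h2

/-- The tangent plane of a differentiable convex function lies below its graph. -/
theorem ConvexOn.inner_gradient_le (hc : ConvexOn ℝ Set.univ φ)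
    (hφ : ∀ x, HasGradientAt φ (φ' x) x) (x y : E) :
    φ x + inner ℝ (φ' x) (y - x) ≤ φ y := by
  have h1 : ConvexOn ℝ Set.univ (fun s : ℝ => φ (x + s • (y - x))) := by
    have := hc.comp_affineMap (AffineMap.lineMap x y : ℝ →ᵃ[ℝ] E)
    simpa [Function.comp_def, AffineMap.lineMap_apply, add_comm] using this
  have h2 := h1.le_slope_of_hasDerivAt (Set.mem_univ 0) (Set.mem_univ 1) one_pos
    (hasDerivAt_comp_line hφ x (y - x) 0)
  simp [slope_def_field] at h2
  linarith

theorem ConcaveOn.le_inner_gradient (hc : ConcaveOn ℝ Set.univ φ)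
    (hφ : ∀ x, HasGradientAt φ (φ' x) x) (x y : E) :
    φ y ≤ φ x + inner ℝ (φ' x) (y - x) := by
  have hφn : ∀ x, HasGradientAt (-φ) (-φ' x) x := fun x => by
    rw [hasGradientAt_iff_hasFDerivAt, map_neg]
    exact (hφ x).hasFDerivAt.neg
  have := hc.neg.inner_gradient_le hφn x y
  simp only [Pi.neg_apply, inner_neg_left] at this
  linarith

theorem hasGradientAt_sub_norm_sq (hφ : ∀ x, HasGradientAt φ (φ' x) x) (m : ℝ) (x : E) :
    HasGradientAt (fun x => φ x - m / 2 * ‖x‖ ^ 2) (φ' x - m • x) x := by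
  have h1 := (hφ x).hasFDerivAt.sub ((hasStrictFDerivAt_norm_sq x).hasFDerivAt.const_mul (m / 2))
  rw [hasGradientAt_iff_hasFDerivAt]
  refine h1.congr_fderiv ?_
  ext y
  simp
  ring

theorem StrongConvexOn.inner_gradient_le (hc : StrongConvexOn Set.univ μ φ)
    (hφ : ∀ x, HasGradientAt φ (φ' x) x) (x y : E) :
    φ x + inner ℝ (φ' x) (y - x) + μ / 2 * ‖y - x‖ ^ 2 ≤ φ y := by
  have h := (strongConvexOn_iff_convex.1 hc).inner_gradient_le
    (fun x => hasGradientAt_sub_norm_sq hφ μ x) x y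
  rw [inner_sub_left, inner_smul_left, inner_sub_right x, real_inner_self_eq_norm_sq] at h
  rw [norm_sub_sq_real, real_inner_comm x y]
  simp only [conj_trivial] at h
  linarith

/-- The descent lemma. -/
theorem descent_lemma (hφ : ∀ x, HasGradientAt φ (φ' x) x)
    (hL : ∀ x y, ‖φ' x - φ' y‖ ≤ L * ‖x - y‖) (x y : E) :
    φ y ≤ φ x + inner ℝ (φ' x) (y - x) + L / 2 * ‖y - x‖ ^ 2 := by
  set v := y - x with hv
  -- `γ` is `φ` on the segment minus its quadratic upper model, up to a constant; its derivative is
  -- nonpositive for `t > 0`, and `γ 1 ≤ γ 0` is the claim.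
  let γ : ℝ → ℝ := fun t => φ (x + t • v) - (t * inner ℝ (φ' x) v + L / 2 * ‖v‖ ^ 2 * t ^ 2)
  have hd : ∀ t, HasDerivAt γ (inner ℝ (φ' (x + t • v)) v -
      (inner ℝ (φ' x) v + L / 2 * ‖v‖ ^ 2 * (2 * t))) t := fun t => by
    refine (hasDerivAt_comp_line hφ x v t).sub (HasDerivAt.add ?_ ?_)
    · simpa using (hasDerivAt_id t).mul_const (inner ℝ (φ' x) v)
    · simpa using (hasDerivAt_pow 2 t).const_mul (L / 2 * ‖v‖ ^ 2)
  have hanti : AntitoneOn γ (Set.Ici 0) := by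
    refine antitoneOn_of_deriv_nonpos (convex_Ici 0)
      (fun t _ => (hd t).continuousAt.continuousWithinAt)
      (fun t _ => (hd t).differentiableAt.differentiableWithinAt) fun t ht => ?_
    rw [interior_Ici] at ht
    have ht : 0 < t := ht
    rw [(hd t).deriv]
    have h1 : inner ℝ (φ' (x + t • v) - φ' x) v ≤ L * (t * ‖v‖) * ‖v‖ := by
      refine (real_inner_le_norm _ _).trans (mul_le_mul_of_nonneg_right ?_ (norm_nonneg _))
      refine (hL _ _).trans_eq ?_
      rw [add_sub_cancel_left, norm_smul, Real.norm_of_nonneg ht.le]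
    rw [inner_sub_left] at h1
    linarith
  have h := hanti (Set.mem_Ici.2 le_rfl) (Set.mem_Ici.2 zero_le_one) zero_le_one
  simp only [γ, one_smul, zero_smul, add_zero] at h
  rw [hv, add_sub_cancel, ← hv] at h
  linarith

/-- A gradient step of length at most `2 / (L + μ)` contracts the gradient. -/
theorem norm_gradient_step_le {T : ℝ} (hφ : ∀ x, HasGradientAt φ (φ' x) x)
    (hμ : ∀ x y, φ x + inner ℝ (φ' x) (y - x) + μ / 2 * ‖y - x‖ ^ 2 ≤ φ y)
    (hL : ∀ x y, ‖φ' x - φ' y‖ ≤ L * ‖x - y‖) (hT : 0 < T) (hμL : μ ≤ L)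
    (hTL : T * (L + μ) ≤ 2) (x : E) :
    ‖φ' (x - T • φ' x)‖ ^ 2 ≤ (1 - μ * T) ^ 2 * ‖φ' x‖ ^ 2 := by
  -- Subtracting `μ/2 ‖x‖²` leaves a convex function that satisfies the quadratic upper bound with
  -- constant `L - μ`.
  have hco := cocoercive_of_bounds (φ := fun x => φ x - μ / 2 * ‖x‖ ^ 2)
    (φ' := fun x => φ' x - μ • x) (sub_nonneg.2 hμL)
    (fun x y => by
      have h := hμ x y
      rw [norm_sub_sq_real, real_inner_comm x y] at h
      rw [inner_sub_left, inner_smul_left, inner_sub_right x, real_inner_self_eq_norm_sq,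
        conj_trivial]
      linarith)
    (fun x y => by
      have h := descent_lemma hφ hL x y
      have e := norm_sub_sq_real y x
      rw [real_inner_comm x y] at e
      rw [inner_sub_left, inner_smul_left, inner_sub_right x, real_inner_self_eq_norm_sq,
        conj_trivial]
      linear_combination h + μ / 2 * e)
    x (x - T • φ' x)
  set u := φ' x
  set u' := φ' (x - T • u)
  have e1 : u - μ • x - (u' - μ • (x - T • u)) = (1 - μ * T) • u - u' := by module
  have e2 : x - (x - T • u) = T • u := by abel
  simp only [e1, e2] at hco
  set e := (1 - μ * T) • u - u'
  have e3 : u' = (1 - μ * T) • u - e := by simp [e]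
  rw [inner_smul_right] at hco
  have hnn : 0 ≤ inner ℝ e u := by
    have h1 := hμ x (x - T • u)
    have h2 := hμ (x - T • u) x
    rw [← neg_sub x (x - T • u), e2, inner_neg_right, norm_neg] at h1
    rw [e2] at h2
    rw [inner_smul_right, norm_smul, Real.norm_of_nonneg hT.le, mul_pow] at h1 h2
    rw [real_inner_self_eq_norm_sq] at h1
    simp only [e, inner_sub_left, inner_smul_left, real_inner_self_eq_norm_sq, conj_trivial]
    refine le_of_mul_le_mul_left (?_ : T * 0 ≤ _) hT
    linarith
  -- The constant comes from `T (L - μ) = T (L + μ) - 2 μ T ≤ 2 (1 - μ T)`. The right side is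
  -- exactly the cross term in the expansion of `‖(1 - μ T) u - e‖²`.
  have h4 : ‖e‖ ^ 2 ≤ 2 * (1 - μ * T) * inner ℝ e u := by
    refine hco.trans ?_
    rw [← mul_assoc]
    exact mul_le_mul_of_nonneg_right (by linarith) hnn
  rw [e3, norm_sub_sq_real, norm_smul, mul_pow, inner_smul_left, real_inner_comm, Real.norm_eq_abs,
    sq_abs, conj_trivial]
  linarith

end FirstOrder

/-! ### Regular problems and combinations of constraints -/

namespace Problem

variable {n nh ng : ℕ} {P : Problem n nh ng} {μ α T L : ℝ}

/-- A differentiable convex problem with a strongly convex objective: the properties of the data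
that the convergence analysis uses, in first-order form. -/
structure Regular (P : Problem n nh ng) (μ : ℝ) : Prop where
  hasGrad_f : ∀ x, HasGradientAt P.f (gradient P.f x) x
  hasGrad_h : ∀ j x, HasGradientAt (P.h j) (gradient (P.h j) x) x
  hasGrad_g : ∀ i x, HasGradientAt (P.g i) (gradient (P.g i) x) x
  cont_f : Continuous (gradient P.f)
  cont_h : ∀ j, Continuous (gradient (P.h j))
  cont_g : ∀ i, Continuous (gradient (P.g i))
  mfcq : ∀ x, P.MFCQ x
  le_f : ∀ x y, P.f x + inner ℝ (gradient P.f x) (y - x) + μ / 2 * ‖y - x‖ ^ 2 ≤ P.f y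
  eq_h : ∀ j x y, P.h j y = P.h j x + inner ℝ (gradient (P.h j) x) (y - x)
  g_le : ∀ i x y, P.g i y ≤ P.g i x + inner ℝ (gradient (P.g i) x) (y - x)

/-- The combination of the constraint functions with multipliers `lam`. -/
def conVal (P : Problem n nh ng) (x : Euc n) (lam : Mult nh ng) : ℝ :=
  ∑ j, lam.1 j * P.h j x + ∑ i, lam.2 i * P.g i x

/-- The combination of the constraint gradients with multipliers `lam`. -/
noncomputable def conGrad (P : Problem n nh ng) (x : Euc n) (lam : Mult nh ng) : Euc n :=
  ∑ j, lam.1 j • gradient (P.h j) x + ∑ i, lam.2 i • gradient (P.g i) x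

theorem conVal_add_smul (x : Euc n) (lam del : Mult nh ng) (t : ℝ) :
    P.conVal x (lam + t • del) = P.conVal x lam + t * P.conVal x del := by
  simp only [conVal, Prod.fst_add, Prod.snd_add, Prod.smul_fst, Prod.smul_snd, Pi.add_apply,
    Pi.smul_apply, smul_eq_mul, add_mul, Finset.sum_add_distrib, mul_add, Finset.mul_sum, mul_assoc]
  ring

theorem conGrad_add_smul (x : Euc n) (lam del : Mult nh ng) (t : ℝ) :
    P.conGrad x (lam + t • del) = P.conGrad x lam + t • P.conGrad x del := by
  simp only [conGrad, Prod.fst_add, Prod.snd_add, Prod.smul_fst, Prod.smul_snd, Pi.add_apply,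
    Pi.smul_apply, smul_eq_mul, add_smul, Finset.sum_add_distrib, smul_add, Finset.smul_sum,
    mul_smul]
  abel

theorem inner_conGrad (x : Euc n) (lam : Mult nh ng) (v : Euc n) :
    inner ℝ (P.conGrad x lam) v = ∑ j, lam.1 j * inner ℝ (gradient (P.h j) x) v +
      ∑ i, lam.2 i * inner ℝ (gradient (P.g i) x) v := by
  simp [conGrad, inner_add_left, sum_inner, inner_smul_left]

theorem inner_conGrad_add_conVal (x : Euc n) (lam : Mult nh ng) (v : Euc n) (a : ℝ) :
    inner ℝ (P.conGrad x lam) v + a * P.conVal x lam =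
      ∑ j, lam.1 j * (inner ℝ (gradient (P.h j) x) v + a * P.h j x) +
      ∑ i, lam.2 i * (inner ℝ (gradient (P.g i) x) v + a * P.g i x) := by
  rw [inner_conGrad, conVal, mul_add, Finset.mul_sum, Finset.mul_sum]
  simp only [mul_add, Finset.sum_add_distrib, mul_left_comm a]
  ring

theorem lagrangian_eq (x : Euc n) (lam : Mult nh ng) :
    P.lagrangian x lam = P.f x - P.conVal x lam := rfl

namespace Regular

theorem continuous_g (hP : P.Regular μ) (i : Fin ng) : Continuous (P.g i) :=
  continuous_iff_continuousAt.2 fun x => (hP.hasGrad_g i x).continuousAt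

theorem continuous_h (hP : P.Regular μ) (j : Fin nh) : Continuous (P.h j) :=
  continuous_iff_continuousAt.2 fun x => (hP.hasGrad_h j x).continuousAt

theorem continuous_f (hP : P.Regular μ) : Continuous P.f :=
  continuous_iff_continuousAt.2 fun x => (hP.hasGrad_f x).continuousAt

theorem continuous_conGrad (hP : P.Regular μ) :
    Continuous fun p : Euc n × Mult nh ng => P.conGrad p.1 p.2 := by
  have h1 := hP.cont_h
  have h2 := hP.cont_g
  unfold conGrad
  fun_prop

theorem continuous_conVal (hP : P.Regular μ) :
    Continuous fun p : Euc n × Mult nh ng => P.conVal p.1 p.2 := by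
  have h1 := hP.continuous_h
  have h2 := hP.continuous_g
  unfold conVal
  fun_prop

theorem hasGradientAt_lagrangian (hP : P.Regular μ) (lam : Mult nh ng) (x : Euc n) :
    HasGradientAt (fun y => P.lagrangian y lam) (gradient P.f x - P.conGrad x lam) x := by
  rw [hasGradientAt_iff_hasFDerivAt]
  have h1 : HasFDerivAt (fun y => ∑ j, lam.1 j * P.h j y)
      (∑ j, lam.1 j • InnerProductSpace.toDual ℝ (Euc n) (gradient (P.h j) x)) x :=
    HasFDerivAt.fun_sum fun j _ => (hP.hasGrad_h j x).hasFDerivAt.const_mul _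
  have h2 : HasFDerivAt (fun y => ∑ i, lam.2 i * P.g i y)
      (∑ i, lam.2 i • InnerProductSpace.toDual ℝ (Euc n) (gradient (P.g i) x)) x :=
    HasFDerivAt.fun_sum fun i _ => (hP.hasGrad_g i x).hasFDerivAt.const_mul _
  refine ((hP.hasGrad_f x).hasFDerivAt.sub (h1.add h2)).congr_fderiv ?_
  simp [conGrad]

theorem gradient_lagrangian (hP : P.Regular μ) (lam : Mult nh ng) (x : Euc n) :
    gradient (fun y => P.lagrangian y lam) x = gradient P.f x - P.conGrad x lam :=
  (hP.hasGradientAt_lagrangian lam x).gradient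

theorem dualObj_eq (hP : P.Regular μ) (x : Euc n) (lam : Mult nh ng) :
    P.dualObj α x lam = P.f x - P.conVal x lam -
      1 / (2 * α) * ‖gradient P.f x - P.conGrad x lam‖ ^ 2 := by
  rw [dualObj, hP.gradient_lagrangian, lagrangian_eq]

/-- The Lagrangian is strongly convex when the inequality multipliers are nonnegative. -/
theorem lagrangian_le (hP : P.Regular μ) {lam : Mult nh ng} (hlam : ∀ i, 0 ≤ lam.2 i)
    (x y : Euc n) :
    P.lagrangian x lam + inner ℝ (gradient P.f x - P.conGrad x lam) (y - x) +
      μ / 2 * ‖y - x‖ ^ 2 ≤ P.lagrangian y lam := by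
  have h1 := hP.le_f x y
  have h2 : P.conVal y lam ≤ P.conVal x lam + inner ℝ (P.conGrad x lam) (y - x) := by
    rw [add_comm, ← one_mul (P.conVal x lam), inner_conGrad_add_conVal, conVal]
    refine add_le_add (Finset.sum_le_sum fun j _ => ?_) (Finset.sum_le_sum fun i _ => ?_)
    · rw [hP.eq_h j x y, one_mul, add_comm (P.h j x)]
    · refine mul_le_mul_of_nonneg_left ?_ (hlam i)
      linarith [hP.g_le i x y]
  rw [lagrangian_eq, lagrangian_eq, inner_sub_left]
  linarith

/-! ### Multiplier bounds and attainment of the dual maximum -/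

/-- By the constraint qualification, the gradient combination bounds admissible multipliers,
uniformly over bounded sets of points. -/
theorem exists_mul_norm_le_conGrad (hP : P.Regular μ) (r : ℝ) :
    ∃ c > 0, ∀ x : Euc n, ‖x‖ ≤ r → ∀ lam ∈ P.D x, c * ‖lam‖ ≤ ‖P.conGrad x lam‖ := by
  -- Writing admissibility as `lam_i = 0 ∨ g_i ≤ 0` exhibits the graph of `D` as closed, so the
  -- normalized pairs form a compact set.
  let S : Set (Euc n × Mult nh ng) :=
    (Metric.closedBall 0 r ×ˢ Metric.sphere 0 1) ∩
      {p | (∀ i, 0 ≤ p.2.2 i) ∧ ∀ i, p.2.2 i = 0 ∨ P.g i p.1 ≤ 0}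
  have hD : ∀ x lam, lam ∈ P.D x ↔ (∀ i, 0 ≤ lam.2 i) ∧ ∀ i, lam.2 i = 0 ∨ P.g i x ≤ 0 :=
    fun x lam => by
      simp only [D, active, Set.mem_ofPred_eq]
      exact and_congr_right fun _ => forall_congr' fun i => by tauto
  have hS : IsCompact S := by
    refine ((isCompact_closedBall _ _).prod (isCompact_sphere _ _)).inter_right ?_
    simp only [Set.ofPred_and, Set.ofPred_forall, Set.ofPred_or]
    refine IsClosed.inter (isClosed_iInter fun i => isClosed_le (by fun_prop) (by fun_prop))
      (isClosed_iInter fun i => IsClosed.union (isClosed_eq (by fun_prop) (by fun_prop)) ?_)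
    exact isClosed_le ((hP.continuous_g i).comp continuous_fst) continuous_const
  have hpos : ∀ p ∈ S, 0 < ‖P.conGrad p.1 p.2‖ := by
    rintro ⟨x, lam⟩ ⟨⟨-, hl⟩, hl0, hlg⟩
    rw [norm_pos_iff]
    intro h0
    simp only at h0 hl0 hlg hl
    obtain ⟨hli, w, hw1, hw2⟩ := hP.mfcq x
    -- Pairing with `w` kills the equality terms and leaves a sum of nonnegative terms, so `lam.2 =
    -- 0`; linear independence then gives `lam.1 = 0`.
    have h1 : inner ℝ (P.conGrad x lam) w = 0 := by rw [h0, inner_zero_left]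
    rw [inner_conGrad, Finset.sum_eq_zero (fun j _ => by rw [hw1, mul_zero]), zero_add] at h1
    have hnn : ∀ i, 0 ≤ lam.2 i * inner ℝ (gradient (P.g i) x) w := fun i => by
      rcases hlg i with h | h
      · rw [h, zero_mul]
      · exact mul_nonneg (hl0 i) (hw2 i h).le
    rw [Finset.sum_eq_zero_iff_of_nonneg fun i _ => hnn i] at h1
    have h2 : lam.2 = 0 := funext fun i => by
      rcases hlg i with h | h
      · exact h
      · exact (mul_eq_zero.1 (h1 i (Finset.mem_univ i))).resolve_right (hw2 i h).ne'
    have h3 : lam.1 = 0 := by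
      rw [conGrad, h2] at h0
      simp only [Pi.zero_apply, zero_smul, Finset.sum_const_zero, add_zero] at h0
      exact funext fun j => Fintype.linearIndependent_iff.1 hli lam.1 h0 j
    have h4 : lam = 0 := Prod.ext h3 h2
    rw [h4] at hl
    simp at hl
  obtain ⟨c, hc, hcS⟩ : ∃ c > 0, ∀ p ∈ S, c ≤ ‖P.conGrad p.1 p.2‖ := by
    rcases S.eq_empty_or_nonempty with h | h
    · exact ⟨1, one_pos, by simp [h]⟩
    · obtain ⟨p, hp, hmin⟩ := hS.exists_isMinOn h hP.continuous_conGrad.norm.continuousOn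
      exact ⟨_, hpos p hp, fun q hq => hmin hq⟩
  refine ⟨c, hc, fun x hx lam hlam => ?_⟩
  rcases eq_or_ne lam 0 with rfl | hne
  · simp
  have hn : 0 < ‖lam‖ := norm_pos_iff.2 hne
  rw [hD] at hlam
  have h1 := hcS (x, ‖lam‖⁻¹ • lam) ⟨⟨by simpa using hx, by
    simp [norm_smul, inv_mul_cancel₀ hn.ne']⟩, fun i => by
      simpa using mul_nonneg (inv_nonneg.2 hn.le) (hlam.1 i), fun i => by
      simpa [hne] using hlam.2 i⟩
  have h2 := conGrad_add_smul (P := P) x 0 lam ‖lam‖⁻¹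
  have h3 : P.conGrad x 0 = 0 := by simp [conGrad]
  rw [zero_add, h3, zero_add] at h2
  simp only [h2, norm_smul, norm_inv, norm_norm] at h1
  rwa [inv_mul_eq_div, le_div_iff₀ hn] at h1

theorem zero_mem_D (x : Euc n) : (0 : Mult nh ng) ∈ P.D x := by simp [D]

theorem neg_conVal_le (x : Euc n) (lam : Mult nh ng) :
    -P.conVal x lam ≤ (∑ j, |P.h j x| + ∑ i, |P.g i x|) * ‖lam‖ := by
  have h : ∀ a b : ℝ, |a| ≤ ‖lam‖ → -(a * b) ≤ |b| * ‖lam‖ := fun a b hab => by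
    refine (neg_le_abs _).trans ?_
    rw [abs_mul, mul_comm]
    exact mul_le_mul_of_nonneg_left hab (abs_nonneg b)
  rw [conVal, neg_add, add_mul, Finset.sum_mul, Finset.sum_mul, ← Finset.sum_neg_distrib,
    ← Finset.sum_neg_distrib]
  exact add_le_add
    (Finset.sum_le_sum fun j _ => h _ _ ((norm_le_pi_norm lam.1 j).trans (norm_fst_le lam)))
    (Finset.sum_le_sum fun i _ => h _ _ ((norm_le_pi_norm lam.2 i).trans (norm_snd_le lam)))

/-- The maximum in the definition of the dual function is attained. -/
theorem exists_isDualMaximizer (hP : P.Regular μ) (hα : 0 < α) (x : Euc n) :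
    ∃ m, P.IsDualMaximizer α x m := by
  obtain ⟨c, hc, hcD⟩ := hP.exists_mul_norm_le_conGrad ‖x‖
  set B := ∑ j, |P.h j x| + ∑ i, |P.g i x| with hB
  have hB0 : 0 ≤ B := by positivity
  set F := ‖gradient P.f x‖ with hF
  have hcont : Continuous (P.dualObj α x) := by
    have h1 := hP.continuous_conVal.comp (Continuous.prodMk_right x)
    have h2 := hP.continuous_conGrad.comp (Continuous.prodMk_right x)
    simp only [Function.comp_def] at h1 h2
    rw [show P.dualObj α x = _ from funext fun lam => hP.dualObj_eq x lam]
    fun_prop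
  have hclosed : IsClosed (P.D x) := by
    simp only [D, Set.ofPred_and, Set.ofPred_forall]
    exact (isClosed_iInter fun i => isClosed_le (by fun_prop) (by fun_prop)).inter
      (isClosed_iInter fun i => isClosed_iInter fun _ => isClosed_eq (by fun_prop) (by fun_prop))
  obtain ⟨m, hm, hmax⟩ := hcont.continuousOn.exists_isMaxOn' hclosed (zero_mem_D x) (by
    rw [eventually_inf_principal]
    -- Coercivity: beyond this radius `(c ‖lam‖ - F)² ≥ 2 α B ‖lam‖ + F²`, so the quadratic term
    -- outweighs the linear one and `lam = 0` is at least as good.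
    filter_upwards [tendsto_norm_cocompact_atTop.eventually_ge_atTop
      ((2 * α * B + 2 * c * F) / c ^ 2)] with lam hlam hD
    have h1 := neg_conVal_le (P := P) x lam
    rw [← hB] at h1
    have h2 := hcD x le_rfl lam hD
    rw [div_le_iff₀ (by positivity)] at hlam
    have h3 : c * ‖lam‖ - F ≤ ‖gradient P.f x - P.conGrad x lam‖ := by
      have := norm_sub_norm_le (P.conGrad x lam) (gradient P.f x)
      rw [norm_sub_rev] at this
      linarith
    have hF0 : 0 ≤ F := norm_nonneg _
    have h4 : 0 ≤ c * ‖lam‖ - F := by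
      have : c * (2 * F) ≤ c * (c * ‖lam‖) := by
        have : 0 ≤ 2 * α * B := by positivity
        linarith
      have := le_of_mul_le_mul_left this hc
      linarith
    have h5 := pow_le_pow_left₀ h4 h3 2
    have h6 : 2 * α * (B * ‖lam‖) + F ^ 2 ≤ (c * ‖lam‖ - F) ^ 2 := by
      have := mul_le_mul_of_nonneg_right hlam (norm_nonneg lam)
      linarith
    have e0 : P.dualObj α x 0 = P.f x - 1 / (2 * α) * F ^ 2 := by
      rw [hP.dualObj_eq]
      simp [conVal, conGrad, hF]
    rw [e0, hP.dualObj_eq]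
    have h7 : B * ‖lam‖ + 1 / (2 * α) * F ^ 2 ≤
        1 / (2 * α) * ‖gradient P.f x - P.conGrad x lam‖ ^ 2 := by
      calc B * ‖lam‖ + 1 / (2 * α) * F ^ 2
          = 1 / (2 * α) * (2 * α * (B * ‖lam‖) + F ^ 2) := by field_simp
        _ ≤ _ := mul_le_mul_of_nonneg_left (h6.trans h5) (by positivity)
    linarith)
  exact ⟨m, hm, hmax⟩

theorem _root_.Problem.IsDualMaximizer.d_eq {x : Euc n} {m : Mult nh ng}
    (hm : P.IsDualMaximizer α x m) : P.d α x = P.dualObj α x m :=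
  IsGreatest.csSup_eq ⟨Set.mem_image_of_mem _ hm.1, Set.forall_mem_image.2 fun _ h => hm.2 h⟩

theorem dualObj_le_d (hP : P.Regular μ) (hα : 0 < α) {x : Euc n} {lam : Mult nh ng}
    (hlam : lam ∈ P.D x) : P.dualObj α x lam ≤ P.d α x := by
  obtain ⟨m, hm⟩ := hP.exists_isDualMaximizer hα x
  rw [hm.d_eq]
  exact hm.2 hlam

/-- First-order optimality of a dual maximizer along an admissible direction. -/
theorem dual_direction_nonneg (hP : P.Regular μ) (hα : 0 < α) {x : Euc n} {m : Mult nh ng}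
    (hm : P.IsDualMaximizer α x m) {del : Mult nh ng} {ε : ℝ} (hε : 0 < ε)
    (hdel : ∀ t, 0 < t → t ≤ ε → m + t • del ∈ P.D x) :
    0 ≤ inner ℝ (P.conGrad x del) (P.conGrad x m - gradient P.f x) + α * P.conVal x del := by
  set q := inner ℝ (P.conGrad x del) (P.conGrad x m - gradient P.f x) + α * P.conVal x del with hq
  -- The objective changes along `del` by exactly `-(t/α) (q + t/2 ‖conGrad del‖²)`; at a maximizer
  -- this is nonpositive, and `t → 0` isolates `q`.
  have key : ∀ t, 0 < t → t ≤ ε → 0 ≤ q + t / 2 * ‖P.conGrad x del‖ ^ 2 := fun t ht hte => by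
    have h1 : P.dualObj α x (m + t • del) ≤ P.dualObj α x m := hm.2 (hdel t ht hte)
    rw [hP.dualObj_eq, hP.dualObj_eq, conVal_add_smul, conGrad_add_smul] at h1
    have e1 : gradient P.f x - (P.conGrad x m + t • P.conGrad x del) =
        -((P.conGrad x m - gradient P.f x) + t • P.conGrad x del) := by abel
    have e2 : gradient P.f x - P.conGrad x m = -(P.conGrad x m - gradient P.f x) := by abel
    rw [e1, e2, norm_neg, norm_neg, norm_add_sq_real, inner_smul_right, norm_smul, mul_pow,
      Real.norm_eq_abs, sq_abs, real_inner_comm] at h1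
    have h2 : 0 ≤ t / α * (q + t / 2 * ‖P.conGrad x del‖ ^ 2) := by
      rw [hq]
      refine le_of_sub_nonneg ?_
      refine (sub_nonneg.2 h1).trans_eq ?_
      field_simp
      ring
    exact nonneg_of_mul_nonneg_right h2 (by positivity)
  have hlim : Tendsto (fun t : ℝ => q + t / 2 * ‖P.conGrad x del‖ ^ 2) (𝓝[>] 0) (𝓝 q) := by
    have : Continuous fun t : ℝ => q + t / 2 * ‖P.conGrad x del‖ ^ 2 := by fun_prop
    simpa using (this.tendsto 0).mono_left nhdsWithin_le_nhds
  refine ge_of_tendsto hlim ?_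
  filter_upwards [Ioc_mem_nhdsGT hε] with t ht using key t ht.1 ht.2

/-! ### Optimality conditions of the dual problem -/

section KKT

variable {x : Euc n} {m : Mult nh ng}

/-- The optimality conditions of a dual maximizer `m`: the velocity `-∇ₓ l(x, m)` is admissible. -/
theorem velocity_mem_V (hP : P.Regular μ) (hα : 0 < α) (hm : P.IsDualMaximizer α x m) :
    P.conGrad x m - gradient P.f x ∈ P.V α x := by
  classical
  refine ⟨fun j => ?_, fun i hi => ?_⟩
  · have hval : ∀ a : ℝ, P.conVal x (Pi.single j a, 0) = a * P.h j x := fun a => by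
      simp [conVal, Pi.single_apply]
    have hgr : ∀ a : ℝ, P.conGrad x (Pi.single j a, 0) = a • gradient (P.h j) x := fun a => by
      simp [conGrad, Pi.single_apply]
    have hmem : ∀ a t : ℝ, m + t • ((Pi.single j a, 0) : Mult nh ng) ∈ P.D x := fun a t =>
      ⟨fun i => by simpa using hm.1.1 i, fun i hi => by simpa using hm.1.2 i hi⟩
    -- Equality multipliers are free, so both signs of the direction are admissible and force an
    -- equation.
    have h1 := hP.dual_direction_nonneg hα hm one_pos fun t _ _ => hmem 1 t
    have h2 := hP.dual_direction_nonneg hα hm one_pos fun t _ _ => hmem (-1) t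
    rw [hval, hgr, inner_smul_left] at h1 h2
    simp only [conj_trivial] at h1 h2
    linarith
  · have h1 := hP.dual_direction_nonneg hα hm (del := (0, Pi.single i 1)) one_pos
      fun t ht _ => ⟨fun k => ?_, fun k hk => ?_⟩
    · simpa [conVal, conGrad, Pi.single_apply] using h1
    · have h2 : (0 : ℝ) ≤ (Pi.single i 1 : Fin ng → ℝ) k := by
        rw [Pi.single_apply]; split_ifs <;> norm_num
      simpa using add_nonneg (hm.1.1 k) (mul_nonneg ht.le h2)
    · have : k ≠ i := fun h => hk (h ▸ hi)
      simpa [this] using hm.1.2 k hk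

/-- Complementary slackness. -/
theorem complementary (hP : P.Regular μ) (hα : 0 < α) (hm : P.IsDualMaximizer α x m)
    {i : Fin ng} (hi : m.2 i ≠ 0) :
    inner ℝ (gradient (P.g i) x) (P.conGrad x m - gradient P.f x) + α * P.g i x = 0 := by
  classical
  have hpos : 0 < m.2 i := (hm.1.1 i).lt_of_ne hi.symm
  have hact : i ∈ P.active x := by_contra fun h => hi (hm.1.2 i h)
  refine le_antisymm ?_ ((hP.velocity_mem_V hα hm).2 i hact)
  -- A positive multiplier can be decreased by up to `m.2 i`, which gives the inequality opposite to
  -- admissibility of the velocity.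
  have h1 := hP.dual_direction_nonneg hα hm (del := (0, Pi.single i (-1))) hpos
    fun t ht hti => ⟨fun k => ?_, fun k hk => ?_⟩
  · have hval : P.conVal x (0, Pi.single i (-1)) = -P.g i x := by
      simp [conVal, Pi.single_apply]
    have hgr : P.conGrad x (0, Pi.single i (-1)) = -gradient (P.g i) x := by
      simp [conGrad, Pi.single_apply]
    rw [hval, hgr, inner_neg_left] at h1
    linarith
  · rcases eq_or_ne k i with rfl | h
    · simpa using hti
    · simpa [h] using hm.1.1 k
  · have : k ≠ i := fun h => hk (h ▸ hact)
    simpa [this] using hm.1.2 k hk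

/-- Admissible multipliers are nonnegative on the constraints that define `V`. -/
theorem inner_conGrad_add_conVal_nonneg {lam : Mult nh ng} (hlam : lam ∈ P.D x) {y : Euc n}
    (hy : y ∈ P.V α x) : 0 ≤ inner ℝ (P.conGrad x lam) y + α * P.conVal x lam := by
  rw [inner_conGrad_add_conVal]
  refine add_nonneg (Finset.sum_nonneg fun j _ => ?_) (Finset.sum_nonneg fun i _ => ?_)
  · rw [hy.1 j, mul_zero]
  · by_cases hi : i ∈ P.active x
    · exact mul_nonneg (hlam.1 i) (hy.2 i hi)
    · rw [hlam.2 i hi, zero_mul]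

theorem inner_conGrad_add_conVal_eq_zero (hP : P.Regular μ) (hα : 0 < α)
    (hm : P.IsDualMaximizer α x m) :
    inner ℝ (P.conGrad x m) (P.conGrad x m - gradient P.f x) + α * P.conVal x m = 0 := by
  rw [inner_conGrad_add_conVal, Finset.sum_eq_zero fun j _ => ?_,
    Finset.sum_eq_zero fun i _ => ?_, add_zero]
  · by_cases hi : m.2 i = 0
    · rw [hi, zero_mul]
    · rw [hP.complementary hα hm hi, mul_zero]
  · rw [(hP.velocity_mem_V hα hm).1 j, mul_zero]

/-- The dual function in terms of the velocity. -/
theorem d_eq_velocity (hP : P.Regular μ) (hα : 0 < α) (hm : P.IsDualMaximizer α x m)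
    {v : Euc n} (hv : v = P.conGrad x m - gradient P.f x) :
    P.d α x = P.f x + 1 / α * (inner ℝ (gradient P.f x) v + ‖v‖ ^ 2 / 2) := by
  have h1 := hP.inner_conGrad_add_conVal_eq_zero hα hm
  have e1 : P.conGrad x m = v + gradient P.f x := by rw [hv]; abel
  have e2 : gradient P.f x - P.conGrad x m = -v := by rw [hv]; abel
  rw [← hv, e1, inner_add_left, real_inner_self_eq_norm_sq] at h1
  rw [hm.d_eq, hP.dualObj_eq, e2, norm_neg]
  have h2 : P.conVal x m = -(‖v‖ ^ 2 + inner ℝ (gradient P.f x) v) / α := by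
    field_simp
    linarith
  rw [h2]
  field_simp
  ring

end KKT

end Regular

/-! ### The velocity as a projection -/

/-- The variational inequality that characterizes the velocity. -/
def VelocityVI (P : Problem n nh ng) (α : ℝ) (x v : Euc n) : Prop :=
  v ∈ P.V α x ∧ ∀ y ∈ P.V α x, 0 ≤ inner ℝ (v + gradient P.f x) (y - v)

/-- Expanding the square, the cross term is nonnegative by the variational inequality. The surplus
`‖y - v‖²` yields both minimality and uniqueness. -/
theorem VelocityVI.norm_sq_le {x v y : Euc n} (h : P.VelocityVI α x v) (hy : y ∈ P.V α x) :
    ‖v + gradient P.f x‖ ^ 2 + ‖y - v‖ ^ 2 ≤ ‖y + gradient P.f x‖ ^ 2 := by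
  have e : y + gradient P.f x = (v + gradient P.f x) + (y - v) := by abel
  rw [e, norm_add_sq_real (v + gradient P.f x)]
  linarith [h.2 y hy]

theorem VelocityVI.isVelocity {x v : Euc n} (h : P.VelocityVI α x v) : P.IsVelocity α x v :=
  ⟨h.1, fun y hy => by
    have := h.norm_sq_le hy
    simp only [Set.mem_ofPred_eq]
    nlinarith [sq_nonneg ‖y - v‖]⟩

theorem VelocityVI.eq_of_isVelocity {x v u : Euc n} (h : P.VelocityVI α x v)
    (hu : P.IsVelocity α x u) : u = v := by
  have h1 := h.norm_sq_le hu.1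
  have h2 := hu.2 h.1
  simp only [Set.mem_ofPred_eq] at h2
  have h3 : ‖u - v‖ ^ 2 ≤ 0 := by linarith
  have h4 : ‖u - v‖ = 0 := by nlinarith [norm_nonneg (u - v)]
  exact sub_eq_zero.1 (norm_eq_zero.1 h4)

theorem Regular.velocityVI (hP : P.Regular μ) (hα : 0 < α) {x : Euc n} {m : Mult nh ng}
    (hm : P.IsDualMaximizer α x m) : P.VelocityVI α x (P.conGrad x m - gradient P.f x) := by
  refine ⟨hP.velocity_mem_V hα hm, fun y hy => ?_⟩
  have h1 := inner_conGrad_add_conVal_nonneg hm.1 hy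
  have h2 := hP.inner_conGrad_add_conVal_eq_zero hα hm
  rw [sub_add_cancel, inner_sub_right]
  linarith

theorem Regular.smoothWith_lagrangian_iff (hP : P.Regular μ) (m : Mult nh ng) :
    SmoothWith L (fun y => P.lagrangian y m) ↔ ∀ x y, ‖(gradient P.f x - P.conGrad x m) -
      (gradient P.f y - P.conGrad y m)‖ ≤ L * ‖x - y‖ := by
  simp only [SmoothWith, hP.gradient_lagrangian]

/-! ### Weak duality and dual ascent -/

/-- Weak duality with a quadratic margin. -/
theorem Regular.d_add_le (hP : P.Regular μ) (hα : 0 < α) {x y : Euc n} (hy : y ∈ P.feasible) :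
    P.d α x + (μ - α) / 2 * ‖y - x‖ ^ 2 ≤ P.f y := by
  obtain ⟨m, hm⟩ := hP.exists_isDualMaximizer hα x
  have h1 := hP.lagrangian_le hm.1.1 x y
  have h2 : P.lagrangian y m ≤ P.f y := by
    rw [lagrangian_eq, sub_le_self_iff]
    exact add_nonneg (Finset.sum_nonneg fun j _ => by rw [hy.2 j, mul_zero])
      (Finset.sum_nonneg fun i _ => mul_nonneg (hm.1.1 i) (hy.1 i))
  rw [hm.d_eq, hP.dualObj_eq, ← lagrangian_eq]
  set u := gradient P.f x - P.conGrad x m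
  -- Completing the square absorbs `|u|²/(2α)` at the cost of `α/2 ‖y - x‖²` from the strong
  -- convexity term.
  have h3 := sq_nonneg ‖u + α • (y - x)‖
  rw [norm_add_sq_real, inner_smul_right, norm_smul, mul_pow, Real.norm_eq_abs, sq_abs] at h3
  have h4 : 0 ≤ 1 / (2 * α) * ‖u‖ ^ 2 + inner ℝ u (y - x) + α / 2 * ‖y - x‖ ^ 2 := by
    refine (mul_nonneg (by positivity : 0 ≤ 1 / (2 * α)) h3).trans_eq ?_
    field_simp
  linarith

/-- One step of the scheme increases the dual function. -/
theorem Regular.d_step (hP : P.Regular μ) (hα : 0 < α) (hαμ : α < μ) (hT : 0 < T) (hμL : μ ≤ L)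
    (hTL : T * (L + μ) ≤ 2) {x v : Euc n} {m : Mult nh ng} (hm : P.IsDualMaximizer α x m)
    (hL : SmoothWith L (fun y => P.lagrangian y m)) (hv : v = P.conGrad x m - gradient P.f x) :
    P.d α x + cOne μ α T * ‖v‖ ^ 2 ≤ P.d α (x + T • v) := by
  have hμT : μ * T ≤ 1 := by nlinarith
  have hαT : 0 ≤ 1 - α * T := by nlinarith
  -- A constraint with positive multiplier satisfies `∇g_i · v = -α g_i`, so concavity gives `g_i(x
  -- + T v) ≤ (1 - α T) g_i(x) ≤ 0`: it stays active.
  have hmem : m ∈ P.D (x + T • v) := by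
    refine ⟨hm.1.1, fun i hi => by_contra fun hne => hi ?_⟩
    have h1 := hP.g_le i x (x + T • v)
    have h2 := hP.complementary hα hm hne
    have h3 : P.g i x ≤ 0 := by_contra fun h => hne (hm.1.2 i h)
    rw [← hv] at h2
    rw [add_sub_cancel_left, inner_smul_right] at h1
    have h4 := mul_nonneg hαT (neg_nonneg.2 h3)
    show P.g i (x + T • v) ≤ 0
    have h5 : T * inner ℝ (gradient (P.g i) x) v = T * (-(α * P.g i x)) := by
      rw [eq_neg_of_add_eq_zero_left h2]
    linarith
  refine le_trans ?_ (hP.dualObj_le_d hα hmem)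
  rw [hm.d_eq, hP.dualObj_eq, hP.dualObj_eq, ← lagrangian_eq, ← lagrangian_eq]
  have h1 := norm_gradient_step_le (hP.hasGradientAt_lagrangian m) (hP.lagrangian_le hm.1.1)
    ((hP.smoothWith_lagrangian_iff m).1 hL) hT hμL hTL x
  have h2 := hP.lagrangian_le hm.1.1 x (x + T • v)
  have e : gradient P.f x - P.conGrad x m = -v := by rw [hv]; abel
  rw [e, smul_neg, sub_neg_eq_add, norm_neg] at h1
  rw [e, add_sub_cancel_left, inner_neg_left, inner_smul_right, real_inner_self_eq_norm_sq,
    norm_smul, mul_pow, Real.norm_eq_abs, sq_abs] at h2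
  rw [e, norm_neg]
  have h3 := mul_le_mul_of_nonneg_left h1 (by positivity : 0 ≤ 1 / (2 * α))
  have e2 : cOne μ α T * ‖v‖ ^ 2 = -(T * ‖v‖ ^ 2) + μ / 2 * (T ^ 2 * ‖v‖ ^ 2) +
      1 / (2 * α) * ‖v‖ ^ 2 - 1 / (2 * α) * ((1 - μ * T) ^ 2 * ‖v‖ ^ 2) := by
    rw [cOne]
    field_simp
    ring
  linarith

/-! ### Optimal multipliers and the duality gap -/

/-- `lam` is a Karush-Kuhn-Tucker multiplier at `x`. -/
structure IsKKT (P : Problem n nh ng) (x : Euc n) (lam : Mult nh ng) : Prop where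
  nonneg : ∀ i, 0 ≤ lam.2 i
  stationary : P.conGrad x lam = gradient P.f x
  conVal_eq : P.conVal x lam = 0

/-- The duality gap is controlled by the velocity if some optimal multiplier is supported on the
active constraints. -/
theorem Regular.gap_le (hP : P.Regular μ) (hα : 0 < α) (hμ : 0 ≤ μ) {x xs v : Euc n}
    {m lam : Mult nh ng} (hm : P.IsDualMaximizer α x m)
    (hv : v = P.conGrad x m - gradient P.f x) (hkkt : P.IsKKT xs lam) (hlam : lam ∈ P.D x)
    (hL : SmoothWith L (fun y => P.lagrangian y lam)) :
    P.f xs - P.d α x ≤ (L / α - 1) / (2 * α) * ‖v‖ ^ 2 := by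
  -- The test point `x + v/α` turns `v ∈ V_α(x)` into nonnegativity of the linearized constraints
  -- paired with `lam`; the Lagrangian there is at least `f xs`.
  have h1 := hP.lagrangian_le hkkt.nonneg xs (x + α⁻¹ • v)
  rw [hkkt.stationary, sub_self, inner_zero_left, lagrangian_eq xs, hkkt.conVal_eq] at h1
  have h2 := descent_lemma (hP.hasGradientAt_lagrangian lam)
    ((hP.smoothWith_lagrangian_iff lam).1 hL) x (x + α⁻¹ • v)
  rw [add_sub_cancel_left, inner_smul_right, inner_sub_left, norm_smul, mul_pow, Real.norm_eq_abs,
    sq_abs, lagrangian_eq x] at h2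
  have hV := hP.velocity_mem_V hα hm
  rw [← hv] at hV
  have h3 := inner_conGrad_add_conVal_nonneg hlam hV
  have h4 : 0 ≤ α⁻¹ * inner ℝ (P.conGrad x lam) v + P.conVal x lam := by
    refine (mul_nonneg (inv_nonneg.2 hα.le) h3).trans_eq ?_
    field_simp
  have h5 : 0 ≤ μ / 2 * ‖x + α⁻¹ • v - xs‖ ^ 2 := by positivity
  rw [hP.d_eq_velocity hα hm hv]
  have e : (L / α - 1) / (2 * α) * ‖v‖ ^ 2 =
      L / 2 * (α⁻¹ ^ 2 * ‖v‖ ^ 2) - 1 / α * (‖v‖ ^ 2 / 2) := by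
    field_simp
  rw [e, mul_add, one_div]
  linarith

/-- Dual maximizers along a convergent sequence with vanishing velocity accumulate at optimal
multipliers; hence eventually some optimal multiplier is supported on the active constraints. -/
theorem Regular.eventually_exists_isKKT (hP : P.Regular μ)
    {x : ℕ → Euc n} {m : ℕ → Mult nh ng} {xs : Euc n} (hxs : xs ∈ P.feasible)
    (hm : ∀ k, m k ∈ P.D (x k)) (hL : ∀ k, SmoothWith L (fun y => P.lagrangian y (m k)))
    (hx : Tendsto x atTop (𝓝 xs))
    (hv : Tendsto (fun k => P.conGrad (x k) (m k) - gradient P.f (x k)) atTop (𝓝 0)) :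
    ∀ᶠ k in atTop, ∃ lam, P.IsKKT xs lam ∧ lam ∈ P.D (x k) ∧
      SmoothWith L (fun y => P.lagrangian y lam) := by
  by_contra hcon
  -- Optimal multipliers need not be unique, so the argument is by contradiction: among infinitely
  -- many bad indices the maximizers accumulate at some `lam`. Where `lam_i ≠ 0`, the approximating
  -- multipliers are eventually nonzero and constraint `i` is active, so `lam` is admissible at a
  -- bad index.
  obtain ⟨φ, hφ, hbad⟩ := extraction_of_frequently_atTop (not_eventually.1 hcon)
  have hgf : Tendsto (fun k => gradient P.f (x k)) atTop (𝓝 (gradient P.f xs)) :=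
    (hP.cont_f.tendsto xs).comp hx
  have hG : Tendsto (fun k => P.conGrad (x k) (m k)) atTop (𝓝 (gradient P.f xs)) := by
    simpa using hv.add hgf
  have hbdd : Bornology.IsBounded (Set.range m) := by
    obtain ⟨r, hr⟩ := (Metric.isBounded_range_of_tendsto x hx).exists_norm_le
    obtain ⟨s, hs⟩ := (Metric.isBounded_range_of_tendsto _ hG).exists_norm_le
    obtain ⟨c, hc, hcD⟩ := hP.exists_mul_norm_le_conGrad r
    refine isBounded_iff_forall_norm_le.2 ⟨s / c, ?_⟩
    rintro _ ⟨k, rfl⟩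
    rw [le_div_iff₀ hc, mul_comm]
    exact (hcD (x k) (hr _ ⟨k, rfl⟩) (m k) (hm k)).trans (hs _ ⟨k, rfl⟩)
  obtain ⟨lam, -, ψ, hψ, hlim⟩ := tendsto_subseq_of_bounded hbdd (x := m ∘ φ)
    fun k => Set.mem_range_self (φ k)
  have hsub : Tendsto (fun k => φ (ψ k)) atTop atTop := hφ.tendsto_atTop.comp hψ.tendsto_atTop
  have hx' : Tendsto (fun k => x (φ (ψ k))) atTop (𝓝 xs) := hx.comp hsub
  have hlim : Tendsto (fun k => m (φ (ψ k))) atTop (𝓝 lam) := hlim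
  have hli : ∀ i, Tendsto (fun k => (m (φ (ψ k))).2 i) atTop (𝓝 (lam.2 i)) := fun i =>
    (((continuous_apply i).comp continuous_snd).tendsto lam).comp hlim
  have hnn : ∀ i, 0 ≤ lam.2 i := fun i => ge_of_tendsto' (hli i) fun k => (hm _).1 i
  have hact : ∀ i, lam.2 i ≠ 0 → ∀ᶠ k in atTop, P.g i (x (φ (ψ k))) ≤ 0 := fun i hi => by
    filter_upwards [(hli i).eventually_ne hi] with k hk
    exact by_contra fun h => hk ((hm _).2 i h)
  have hkkt : P.IsKKT xs lam := by
    refine ⟨hnn, ?_, ?_⟩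
    · have h1 := (hP.continuous_conGrad.tendsto (xs, lam)).comp (hx'.prodMk_nhds hlim)
      exact tendsto_nhds_unique h1 (hG.comp hsub)
    · rw [conVal, Finset.sum_eq_zero fun j _ => by rw [hxs.2 j, mul_zero],
        Finset.sum_eq_zero fun i _ => ?_, add_zero]
      by_cases hi : lam.2 i = 0
      · rw [hi, zero_mul]
      · have h1 : P.g i xs ≤ 0 :=
          le_of_tendsto (((hP.continuous_g i).tendsto xs).comp hx') (hact i hi)
        rw [le_antisymm h1 (hxs.1 i), mul_zero]
  have hsm : SmoothWith L (fun y => P.lagrangian y lam) := by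
    rw [hP.smoothWith_lagrangian_iff]
    intro y z
    have ht : ∀ y, Tendsto (fun k => P.conGrad y (m (φ (ψ k)))) atTop (𝓝 (P.conGrad y lam)) :=
      fun y => by
        have h1 : Continuous fun l => P.conGrad y l :=
          hP.continuous_conGrad.comp (Continuous.prodMk_right y)
        exact (h1.tendsto lam).comp hlim
    have h1 := (((ht y).const_sub (gradient P.f y)).sub ((ht z).const_sub (gradient P.f z))).norm
    exact le_of_tendsto' h1 fun k => (hP.smoothWith_lagrangian_iff (m (φ (ψ k)))).1 (hL _) y z
  have hev : ∀ᶠ k in atTop, ∀ i, lam.2 i ≠ 0 → P.g i (x (φ (ψ k))) ≤ 0 :=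
    eventually_all.2 fun i => by
      by_cases hi : lam.2 i = 0
      · simp [hi]
      · filter_upwards [hact i hi] with k hk _ using hk
  obtain ⟨k, hk⟩ := hev.exists
  exact hbad (ψ k) ⟨lam, hkkt, ⟨hnn, fun i hi => by_contra fun h => hi (hk i h)⟩, hsm⟩

/-- A limit of points whose admissible velocities vanish is feasible. -/
theorem Regular.mem_feasible_of_tendsto (hP : P.Regular μ) (hα : 0 < α) {x v : ℕ → Euc n}
    {xb : Euc n} (hx : Tendsto x atTop (𝓝 xb)) (hv : Tendsto v atTop (𝓝 0))
    (hV : ∀ k, v k ∈ P.V α (x k)) : xb ∈ P.feasible := by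
  refine ⟨fun i => ?_, fun j => ?_⟩
  -- The absolute value makes the expression nonnegative for active and inactive constraints alike.
  · have h1 : Tendsto (fun k => |inner ℝ (gradient (P.g i) (x k)) (v k)| + α * P.g i (x k)) atTop
        (𝓝 (|inner ℝ (gradient (P.g i) xb) 0| + α * P.g i xb)) :=
      ((((hP.cont_g i).tendsto xb).comp hx).inner hv).abs.add
        ((((hP.continuous_g i).tendsto xb).comp hx).const_mul α)
    have h2 := ge_of_tendsto' h1 (b := 0) fun k => by
      rcases le_or_gt (P.g i (x k)) 0 with h | h
      · linarith [(hV k).2 i h, le_abs_self (inner ℝ (gradient (P.g i) (x k)) (v k))]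
      · positivity
    rw [inner_zero_right, abs_zero, zero_add] at h2
    exact nonneg_of_mul_nonneg_right h2 hα
  · have h1 : Tendsto (fun k => inner ℝ (gradient (P.h j) (x k)) (v k) + α * P.h j (x k)) atTop
        (𝓝 (inner ℝ (gradient (P.h j) xb) 0 + α * P.h j xb)) :=
      ((((hP.cont_h j).tendsto xb).comp hx).inner hv).add
        ((((hP.continuous_h j).tendsto xb).comp hx).const_mul α)
    have h2 := tendsto_nhds_unique h1 (tendsto_const_nhds.congr fun k => ((hV k).1 j).symm)
    rw [inner_zero_right, zero_add] at h2
    exact (mul_eq_zero.1 h2).resolve_left hα.ne'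

/-! ### Parameters and constants -/

/-- The hypotheses on the parameters of the scheme and on the choice `lam` of dual maximizers. -/
structure Setup (P : Problem n nh ng) (μ α T L : ℝ) (lam : Euc n → Mult nh ng) : Prop where
  reg : P.Regular μ
  α_pos : 0 < α
  α_lt : α < μ
  T_pos : 0 < T
  μ_le : μ ≤ L
  T_mul_le : T * (L + μ) ≤ 2
  isMax : ∀ x, P.IsDualMaximizer α x (lam x)
  smooth : ∀ x, SmoothWith L (fun y => P.lagrangian y (lam x))

/-- The velocity field of the scheme. -/
noncomputable def vel (P : Problem n nh ng) (lam : Euc n → Mult nh ng) (x : Euc n) : Euc n :=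
  P.conGrad x (lam x) - gradient P.f x

namespace Setup

variable {lam : Euc n → Mult nh ng}

theorem velocityVI (S : P.Setup μ α T L lam) (x : Euc n) : P.VelocityVI α x (P.vel lam x) :=
  S.reg.velocityVI S.α_pos (S.isMax x)

theorem mul_T_le_one (S : P.Setup μ α T L lam) : μ * T ≤ 1 := by
  nlinarith [S.T_pos, S.μ_le, S.T_mul_le]

theorem cOne_pos (S : P.Setup μ α T L lam) : 0 < cOne μ α T := by
  have h1 := S.mul_T_le_one
  have h2 : 0 < μ / α - 1 := sub_pos.2 ((one_lt_div S.α_pos).2 S.α_lt)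
  exact mul_pos (mul_pos S.T_pos h2) (by linarith)

theorem cTwo_pos (S : P.Setup μ α T L lam) : 0 < cTwo μ α T L := by
  have h1 := S.mul_T_le_one
  have h2 := S.α_pos
  have h3 := S.α_lt
  have h4 := S.μ_le
  exact div_pos (mul_pos (mul_pos (by linarith) (by linarith)) (by linarith)) (by linarith)

theorem cTwo_mul_lt_one (S : P.Setup μ α T L lam) : cTwo μ α T L * T < 1 := by
  have h1 := S.mul_T_le_one
  have h2 := S.α_pos
  have h3 := S.α_lt
  have h4 := S.μ_le
  have h5 := S.T_pos
  rw [cTwo, div_mul_eq_mul_div, div_lt_one (by linarith)]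
  -- Replacing `α` by `μ` gives the strict upper bound `2 s (1 - s/2) = 1 - (1 - s)²` with `s = μ
  -- T`.
  have h6 : 2 * α * (1 - μ * T / 2) * T < 1 := by
    have : α * T < μ * T := mul_lt_mul_of_pos_right h3 h5
    have h7 : 0 < 1 - μ * T / 2 := by linarith
    nlinarith [mul_lt_mul_of_pos_right this h7, sq_nonneg (1 - μ * T)]
  nlinarith

/-- This identity determines `c₂`: the last factor is the constant of the gap bound, so an increase
of `d` by `c₁ |v|²` removes at least the fraction `c₂ T` of the gap. -/
theorem cOne_eq_cTwo_mul (S : P.Setup μ α T L lam) :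
    cOne μ α T = cTwo μ α T L * T * ((L / α - 1) / (2 * α)) := by
  have h2 := S.α_pos
  have h3 := S.α_lt
  have h4 := S.μ_le
  have h5 : L - α ≠ 0 := by linarith
  rw [cOne, cTwo]
  field_simp

/-! ### Convergence and rates along the iterates -/

section Iterates

variable {x : ℕ → Euc n}

theorem d_step (S : P.Setup μ α T L lam) (hx : ∀ k, x (k + 1) = x k + T • P.vel lam (x k)) (k : ℕ) :
    P.d α (x k) + cOne μ α T * ‖P.vel lam (x k)‖ ^ 2 ≤ P.d α (x (k + 1)) := by
  rw [hx k]
  exact S.reg.d_step S.α_pos S.α_lt S.T_pos S.μ_le S.T_mul_le (S.isMax _) (S.smooth _) rfl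

theorem monotone_d (S : P.Setup μ α T L lam) (hx : ∀ k, x (k + 1) = x k + T • P.vel lam (x k)) :
    Monotone fun k => P.d α (x k) :=
  monotone_nat_of_le_succ fun k =>
    (le_add_of_nonneg_right (mul_nonneg S.cOne_pos.le (sq_nonneg _))).trans (S.d_step hx k)

theorem d_le (S : P.Setup μ α T L lam) {xs : Euc n} (hxs : xs ∈ P.feasible) (x : Euc n) :
    P.d α x ≤ P.f xs := by
  have h := S.reg.d_add_le S.α_pos (x := x) hxs
  have := mul_nonneg (half_pos (sub_pos.2 S.α_lt)).le (sq_nonneg ‖xs - x‖)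
  linarith

theorem norm_sub_sq_le (S : P.Setup μ α T L lam) {xs : Euc n} (hxs : xs ∈ P.feasible) (x : Euc n) :
    ‖xs - x‖ ^ 2 ≤ 2 / (μ - α) * (P.f xs - P.d α x) := by
  have h := S.reg.d_add_le S.α_pos (x := x) hxs
  have h1 := sub_pos.2 S.α_lt
  rw [div_mul_eq_mul_div, le_div_iff₀ h1]
  linarith

theorem sum_norm_vel_sq_le (S : P.Setup μ α T L lam)
    (hx : ∀ k, x (k + 1) = x k + T • P.vel lam (x k)) (k : ℕ) :
    cOne μ α T * ∑ j ∈ Finset.range k, ‖P.vel lam (x j)‖ ^ 2 ≤ P.d α (x k) - P.d α (x 0) := by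
  rw [Finset.mul_sum, ← Finset.sum_range_sub (fun k => P.d α (x k))]
  exact Finset.sum_le_sum fun j _ => by linarith [S.d_step hx j]

/-- The increments of `d` telescope and `d` is bounded above by the objective at any feasible point,
so the squared velocities are summable. -/
theorem tendsto_vel (S : P.Setup μ α T L lam) (hx : ∀ k, x (k + 1) = x k + T • P.vel lam (x k))
    (hne : P.feasible.Nonempty) : Tendsto (fun k => P.vel lam (x k)) atTop (𝓝 0) := by
  obtain ⟨xs, hxs⟩ := hne
  have hsum : Summable fun k => ‖P.vel lam (x k)‖ ^ 2 := by
    refine summable_of_sum_range_le (c := (P.f xs - P.d α (x 0)) / cOne μ α T)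
      (fun k => sq_nonneg _) fun k => ?_
    rw [le_div_iff₀ S.cOne_pos, mul_comm]
    linarith [S.sum_norm_vel_sq_le hx k, S.d_le hxs (x k)]
  rw [tendsto_zero_iff_norm_tendsto_zero]
  have := hsum.tendsto_atTop_zero.sqrt
  simpa [Real.sqrt_sq] using this

theorem tendsto_d (S : P.Setup μ α T L lam) (hx : ∀ k, x (k + 1) = x k + T • P.vel lam (x k))
    {xs : Euc n} (hxs : xs ∈ P.feasible) (hmin : IsMinOn P.f P.feasible xs) :
    Tendsto (fun k => P.d α (x k)) atTop (𝓝 (P.f xs)) := by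
  have hbd : BddAbove (Set.range fun k => P.d α (x k)) :=
    ⟨P.f xs, by rintro _ ⟨k, rfl⟩; exact S.d_le hxs _⟩
  have hd := tendsto_atTop_ciSup (S.monotone_d hx) hbd
  have hv := S.tendsto_vel hx ⟨xs, hxs⟩
  have hxb : Bornology.IsBounded (Set.range x) := by
    refine (Metric.isBounded_closedBall (x := xs)
      (r := √(2 / (μ - α) * (P.f xs - P.d α (x 0))))).subset ?_
    rintro _ ⟨k, rfl⟩
    rw [Metric.mem_closedBall, dist_comm, dist_eq_norm]
    refine Real.le_sqrt_of_sq_le ((S.norm_sub_sq_le hxs (x k)).trans ?_)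
    have h1 := sub_pos.2 S.α_lt
    exact mul_le_mul_of_nonneg_left (by linarith [S.monotone_d hx (Nat.zero_le k)]) (by positivity)
  obtain ⟨xb, -, φ, hφ, hlim⟩ := tendsto_subseq_of_bounded hxb (x := x) Set.mem_range_self
  have hvφ := hv.comp hφ.tendsto_atTop
  have hfeas : xb ∈ P.feasible := S.reg.mem_feasible_of_tendsto S.α_pos hlim hvφ
    fun k => (S.velocityVI _).1
  -- Continuity of `d` is not needed: its expression through the velocity converges because the
  -- velocity vanishes.
  have hdf : Tendsto (fun k => P.d α (x (φ k))) atTop (𝓝 (P.f xb)) := by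
    have h1 : Tendsto (fun k => P.f (x (φ k)) + 1 / α *
        (inner ℝ (gradient P.f (x (φ k))) (P.vel lam (x (φ k))) + ‖P.vel lam (x (φ k))‖ ^ 2 / 2))
        atTop (𝓝 (P.f xb + 1 / α *
          (inner ℝ (gradient P.f xb) 0 + ‖(0 : Euc n)‖ ^ 2 / 2))) :=
      ((S.reg.continuous_f.tendsto xb).comp hlim).add (((((S.reg.cont_f.tendsto xb).comp hlim).inner
        hvφ).add ((hvφ.norm.pow 2).div_const 2)).const_mul (1 / α))
    simp only [inner_zero_right, norm_zero, zero_pow two_ne_zero, zero_div, add_zero,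
      mul_zero] at h1
    exact h1.congr fun k => (S.reg.d_eq_velocity S.α_pos (S.isMax _) rfl).symm
  -- The limit of `d` is squeezed: `f xb = sup d ≤ f xs ≤ f xb`.
  have heq := tendsto_nhds_unique hdf (hd.comp hφ.tendsto_atTop)
  have hle : (⨆ k, P.d α (x k)) ≤ P.f xs := ciSup_le fun k => S.d_le hxs _
  have hge : P.f xs ≤ P.f xb := hmin hfeas
  rwa [← heq, le_antisymm (heq.trans_le hle) hge] at hd

theorem tendsto_iterates (S : P.Setup μ α T L lam)
    (hx : ∀ k, x (k + 1) = x k + T • P.vel lam (x k))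
    {xs : Euc n} (hxs : xs ∈ P.feasible) (hmin : IsMinOn P.f P.feasible xs) :
    Tendsto x atTop (𝓝 xs) := by
  have h1 : Tendsto (fun k => ‖xs - x k‖ ^ 2) atTop (𝓝 0) := by
    refine squeeze_zero (fun k => sq_nonneg _) (fun k => S.norm_sub_sq_le hxs (x k)) ?_
    simpa using ((S.tendsto_d hx hxs hmin).const_sub (P.f xs)).const_mul (2 / (μ - α))
  rw [tendsto_iff_norm_sub_tendsto_zero]
  have := h1.sqrt
  simpa [Real.sqrt_sq, norm_sub_rev xs] using this

theorem inf_norm_vel_sq_le (S : P.Setup μ α T L lam)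
    (hx : ∀ k, x (k + 1) = x k + T • P.vel lam (x k)) {xs : Euc n} (hxs : xs ∈ P.feasible) (k : ℕ) :
    (Finset.range (k + 1)).inf' Finset.nonempty_range_add_one (fun j => ‖P.vel lam (x j)‖ ^ 2) ≤
      (P.f xs - P.d α (x 0)) / (cOne μ α T * (k + 1)) := by
  have hc := S.cOne_pos
  rw [le_div_iff₀ (by positivity)]
  have h1 := Finset.card_nsmul_le_sum (Finset.range (k + 1)) (fun j => ‖P.vel lam (x j)‖ ^ 2)
    ((Finset.range (k + 1)).inf' Finset.nonempty_range_add_one fun j => ‖P.vel lam (x j)‖ ^ 2)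
    fun j hj => Finset.inf'_le (fun j => ‖P.vel lam (x j)‖ ^ 2) hj
  rw [Finset.card_range, nsmul_eq_mul] at h1
  push_cast at h1
  have h2 := mul_le_mul_of_nonneg_left h1 hc.le
  linarith [S.sum_norm_vel_sq_le hx (k + 1), S.d_le hxs (x (k + 1))]

/-- Eventually the duality gap decreases linearly. -/
theorem exists_gap_linear (S : P.Setup μ α T L lam)
    (hx : ∀ k, x (k + 1) = x k + T • P.vel lam (x k))
    {xs : Euc n} (hxs : xs ∈ P.feasible) (hmin : IsMinOn P.f P.feasible xs) :
    ∃ N₀ : ℕ, ∀ N ≥ N₀, ∀ k ≥ N, P.f xs - P.d α (x k) ≤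
      (1 - cTwo μ α T L * T) ^ (k - N) * (P.f xs - P.d α (x N)) := by
  obtain ⟨N₀, hN₀⟩ := eventually_atTop.1 (S.reg.eventually_exists_isKKT hxs
    (fun k => (S.isMax (x k)).1) (fun k => S.smooth (x k)) (S.tendsto_iterates hx hxs hmin)
    (S.tendsto_vel hx ⟨xs, hxs⟩))
  refine ⟨N₀, fun N hN k hk => ?_⟩
  induction k, hk using Nat.le_induction with
  | base => simp
  | succ k hk ih =>
    obtain ⟨l, hkkt, hl, hsm⟩ := hN₀ k (hN.le.trans hk)
    have hμ : 0 ≤ μ := (S.α_pos.trans S.α_lt).le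
    have h1 : P.f xs - P.d α (x k) ≤ (L / α - 1) / (2 * α) * ‖P.vel lam (x k)‖ ^ 2 :=
      S.reg.gap_le S.α_pos hμ (S.isMax _) rfl hkkt hl hsm
    have h2 := S.d_step hx k
    have h3 := mul_le_mul_of_nonneg_left h1 (mul_pos S.cTwo_pos S.T_pos).le
    rw [← mul_assoc, ← S.cOne_eq_cTwo_mul] at h3
    have h4 := mul_le_mul_of_nonneg_left ih (sub_pos.2 S.cTwo_mul_lt_one).le
    rw [Nat.succ_sub hk, pow_succ']
    linarith

theorem norm_vel_sq_le (S : P.Setup μ α T L lam) (hx : ∀ k, x (k + 1) = x k + T • P.vel lam (x k))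
    {xs : Euc n} (hxs : xs ∈ P.feasible) (k : ℕ) :
    ‖P.vel lam (x k)‖ ^ 2 ≤ 1 / cOne μ α T * (P.f xs - P.d α (x k)) := by
  rw [one_div_mul_eq_div, le_div_iff₀ S.cOne_pos]
  linarith [S.d_step hx k, S.d_le hxs (x (k + 1))]

/-- It suffices that `c₁ α ≤ L/α - 1`, which follows from `α T (1 - μ T/2) ≤ 1` and `μ ≤ L`. It
passes from the constant of the quadratic margin to the stated one. -/
theorem two_div_le (S : P.Setup μ α T L lam) :
    2 / (μ - α) ≤ 2 * (L / α - 1) / (cOne μ α T * α * (μ - α)) := by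
  have hc := S.cOne_pos
  have h1 := S.mul_T_le_one
  have h2 := S.α_pos
  have h3 := S.α_lt
  have h4 := S.μ_le
  have h5 := S.T_pos
  have h6 : 0 < μ - α := sub_pos.2 h3
  rw [div_le_div_iff₀ h6 (by positivity)]
  have key : cOne μ α T * α ≤ L / α - 1 := by
    rw [le_sub_iff_add_le, le_div_iff₀ h2, cOne]
    have e : (T * (μ / α - 1) * (1 - μ * T / 2) * α + 1) * α =
        (μ - α) * (α * T * (1 - μ * T / 2)) + α := by
      field_simp
    rw [e]
    have h7 : α * T * (1 - μ * T / 2) ≤ 1 := by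
      have : α * T ≤ μ * T := mul_le_mul_of_nonneg_right h3.le h5.le
      have h8 : 0 ≤ μ * T := by nlinarith
      have h9 : 0 ≤ α * T := by positivity
      nlinarith
    nlinarith
  nlinarith

/-- The linear rate eventually beats the sublinear bound for the iterates. -/
theorem exists_rates (S : P.Setup μ α T L lam)
    (hx : ∀ k, x (k + 1) = x k + T • P.vel lam (x k))
    {xs : Euc n} (hxs : xs ∈ P.feasible) (hmin : IsMinOn P.f P.feasible xs) :
    ∃ N : ℕ, ∀ k ≥ N,
      ‖P.vel lam (x k)‖ ^ 2 ≤
        2 / cOne μ α T * (1 - cTwo μ α T L * T) ^ (k - N) * (P.f xs - P.d α (x N)) ∧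
      (Finset.range (k + 1)).inf' Finset.nonempty_range_add_one (fun j => ‖xs - x j‖ ^ 2) ≤
        (L / α - 1) / (cOne μ α T * α * (μ - α)) * ((P.f xs - P.d α (x 0)) / (k + 1)) ∧
      ‖xs - x k‖ ^ 2 ≤ 2 * (L / α - 1) / (cOne μ α T * α * (μ - α)) *
        (1 - cTwo μ α T L * T) ^ (k - N) * (P.f xs - P.d α (x N)) := by
  obtain ⟨N₀, hN₀⟩ := S.exists_gap_linear hx hxs hmin
  have hc := S.cOne_pos
  have hα := S.α_pos
  have hμα : 0 < μ - α := sub_pos.2 S.α_lt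
  have hLα : 0 < L / α - 1 := sub_pos.2 ((one_lt_div hα).2 (S.α_lt.trans_le S.μ_le))
  set q := 1 - cTwo μ α T L * T with hq
  have hq0 : 0 < q := sub_pos.2 S.cTwo_mul_lt_one
  have hq1 : q < 1 := by linarith [mul_pos S.cTwo_pos S.T_pos]
  set B := (L / α - 1) / (cOne μ α T * α * (μ - α)) with hB
  have hB0 : 0 < B := by positivity
  have hgap : ∀ k, 0 ≤ P.f xs - P.d α (x k) := fun k => sub_nonneg.2 (S.d_le hxs _)
  -- Geometric decay beats `1/(k + 1)`, so for large `k` the last term alone satisfies the bound on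
  -- the minimum. The limit is computed with `k + 1 = (k - N₀) + (N₀ + 1)`.
  have hexp : ∀ᶠ k : ℕ in atTop, 2 / (μ - α) * q ^ (k - N₀) * (k + 1) ≤ B := by
    have h1 : Tendsto (fun k : ℕ => 2 / (μ - α) * (k * q ^ k + (N₀ + 1) * q ^ k)) atTop
        (𝓝 (2 / (μ - α) * (0 + (N₀ + 1) * 0))) :=
      ((tendsto_self_mul_const_pow_of_lt_one hq0.le hq1).add
        ((tendsto_pow_atTop_nhds_zero_of_lt_one hq0.le hq1).const_mul _)).const_mul _
    have h2 := (h1.comp (tendsto_sub_atTop_nat N₀)).eventually_le_const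
      (by simpa using hB0 : 2 / (μ - α) * (0 + ((N₀ : ℝ) + 1) * 0) < B)
    filter_upwards [h2, eventually_ge_atTop N₀] with k hk hkN
    refine le_of_eq_of_le ?_ hk
    simp only [Function.comp_apply]
    rw [Nat.cast_sub hkN]
    ring
  obtain ⟨N₁, hN₁⟩ := eventually_atTop.1 hexp
  refine ⟨max N₀ N₁, fun k hk => ?_⟩
  have hlin := hN₀ _ (le_max_left N₀ N₁) k hk
  refine ⟨?_, ?_, ?_⟩
  · refine (S.norm_vel_sq_le hx hxs k).trans ?_
    rw [mul_assoc (2 / _)]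
    refine mul_le_mul ?_ hlin (hgap k) (by positivity)
    gcongr
    norm_num
  · refine (Finset.inf'_le _ (Finset.self_mem_range_succ k)).trans
      ((S.norm_sub_sq_le hxs (x k)).trans ?_)
    have h1 := hN₀ N₀ le_rfl k ((le_max_left _ _).trans hk)
    have h2 := hN₁ k ((le_max_right _ _).trans hk)
    have h3 : P.d α (x 0) ≤ P.d α (x N₀) := S.monotone_d hx (Nat.zero_le N₀)
    rw [← mul_div_assoc, le_div_iff₀ (by positivity)]
    calc 2 / (μ - α) * (P.f xs - P.d α (x k)) * (k + 1)
        ≤ 2 / (μ - α) * (q ^ (k - N₀) * (P.f xs - P.d α (x 0))) * (k + 1) := by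
          have h4 : q ^ (k - N₀) * (P.f xs - P.d α (x N₀)) ≤
              q ^ (k - N₀) * (P.f xs - P.d α (x 0)) :=
            mul_le_mul_of_nonneg_left (by linarith) (by positivity)
          have h5 := h1.trans h4
          gcongr
      _ = 2 / (μ - α) * q ^ (k - N₀) * (k + 1) * (P.f xs - P.d α (x 0)) := by ring
      _ ≤ B * (P.f xs - P.d α (x 0)) := mul_le_mul_of_nonneg_right h2 (hgap 0)
  · refine (S.norm_sub_sq_le hxs (x k)).trans ?_
    rw [mul_assoc (2 * (L / α - 1) / _)]
    exact mul_le_mul S.two_div_le hlin (hgap k) (by positivity)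

end Iterates

/-! ### Well-posedness of the scheme -/

/-- The scheme is the explicit Euler scheme of the velocity field. -/
theorem isRun_iff (S : P.Setup μ α T L lam) {x R : ℕ → Euc n} :
    P.IsRun α T x R ↔ (∀ k, x (k + 1) = x k + T • P.vel lam (x k)) ∧
      ∀ k, R k = P.vel lam (x k) + gradient P.f (x k) := by
  have hT := S.T_pos.ne'
  constructor
  · intro h
    rw [← forall_and]
    intro k
    obtain ⟨h1, h2⟩ := h k
    set u := (1 / T) • (x (k + 1) - x k) with hu
    have hu1 : x (k + 1) = x k + T • u := by
      rw [hu, smul_smul, mul_one_div_cancel hT, one_smul, add_sub_cancel]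
    have hu2 : u = -gradient P.f (x k) + R k := by
      have : x (k + 1) - x k = T • (-gradient P.f (x k) + R k) := by rw [h1]; module
      rw [hu, this, smul_smul, one_div_mul_cancel hT, one_smul]
    -- Since `R k = u + ∇f(x k)`, the subdifferential inclusion is the variational inequality for
    -- `u`.
    have hvi : P.VelocityVI α (x k) u := by
      refine ⟨h2.1, fun y hy => ?_⟩
      have h3 := h2.2 y hy
      have e : u + gradient P.f (x k) = R k := by rw [hu2]; abel
      rw [inner_neg_left] at h3
      rw [e]
      linarith
    have heq : u = P.vel lam (x k) := (S.velocityVI (x k)).eq_of_isVelocity hvi.isVelocity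
    rw [← heq]
    exact ⟨hu1, by rw [hu2]; abel⟩
  · rintro ⟨h1, h2⟩ k
    have e : (1 / T) • (x (k + 1) - x k) = P.vel lam (x k) := by
      rw [h1, add_sub_cancel_left, smul_smul, one_div_mul_cancel hT, one_smul]
    refine ⟨by rw [h1, h2]; module, ?_⟩
    rw [e]
    refine ⟨(S.velocityVI _).1, fun y hy => ?_⟩
    rw [h2, inner_neg_left]
    linarith [(S.velocityVI (x k)).2 y hy]

theorem existsUnique_run (S : P.Setup μ α T L lam) (x₀ : Euc n) :
    ∃! p : (ℕ → Euc n) × (ℕ → Euc n), p.1 0 = x₀ ∧ P.IsRun α T p.1 p.2 := by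
  let x : ℕ → Euc n := fun k => Nat.rec x₀ (fun _ y => y + T • P.vel lam y) k
  refine ⟨(x, fun k => P.vel lam (x k) + gradient P.f (x k)),
    ⟨rfl, S.isRun_iff.2 ⟨fun k => rfl, fun k => rfl⟩⟩, ?_⟩
  rintro ⟨y, R⟩ ⟨h0, hrun⟩
  obtain ⟨h1, h2⟩ := S.isRun_iff.1 hrun
  simp only at h0 h1 h2
  have hyx : y = x := funext fun k => by
    induction k with
    | zero => exact h0
    | succ k ih => rw [h1, ih]
  subst hyx
  exact Prod.ext rfl (funext h2)

end Setup

/-! ### From the convexity hypotheses to the first-order form -/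

/-- The gradient of an affine function is constant. -/
theorem gradient_affine {φ : Euc n → ℝ} (hφ : ∃ A : Euc n →ᵃ[ℝ] ℝ, ∀ x, φ x = A x) :
    ∃ a : Euc n, ∀ x, HasGradientAt φ a x ∧ ∀ y, φ y = φ x + inner ℝ a (y - x) := by
  obtain ⟨A, hA⟩ := hφ
  let l := A.linear.toContinuousLinearMap
  have hl : ∀ x y, φ y = φ x + l (y - x) := fun x y => by
    have := A.map_vadd x (y - x)
    simp only [vadd_eq_add, sub_add_cancel] at this
    rw [hA, hA, this, add_comm]
    rfl
  refine ⟨(InnerProductSpace.toDual ℝ (Euc n)).symm l, fun x => ⟨?_, fun y => ?_⟩⟩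
  · rw [hasGradientAt_iff_hasFDerivAt, LinearIsometryEquiv.apply_symm_apply]
    have h1 : φ = fun y => φ 0 + l y := funext fun y => by rw [hl 0 y, sub_zero]
    rw [h1]
    exact l.hasFDerivAt.const_add _
  · rw [InnerProductSpace.toDual_symm_apply]
    exact hl x y

theorem regular_of_convex (hf : LipGrad P.f) (hh : ∀ j, LipGrad (P.h j)) (hg : ∀ i, LipGrad (P.g i))
    (hMF : ∀ x, P.MFCQ x) (hhaff : ∀ j, ∃ A : Euc n →ᵃ[ℝ] ℝ, ∀ x, P.h j x = A x)
    (hgconc : ∀ i, ConcaveOn ℝ Set.univ (P.g i)) (hμ : StrongConvexOn Set.univ μ P.f) :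
    P.Regular μ := by
  have hd : ∀ {φ : Euc n → ℝ}, LipGrad φ → ∀ x, HasGradientAt φ (gradient φ x) x :=
    fun h x => ((h.1.differentiable one_ne_zero) x).hasGradientAt
  have hcont : ∀ {φ : Euc n → ℝ}, LipGrad φ → Continuous (gradient φ) :=
    fun h => h.2.choose_spec.continuous
  exact
    { hasGrad_f := hd hf
      hasGrad_h := fun j => hd (hh j)
      hasGrad_g := fun i => hd (hg i)
      cont_f := hcont hf
      cont_h := fun j => hcont (hh j)
      cont_g := fun i => hcont (hg i)
      mfcq := hMF
      le_f := hμ.inner_gradient_le (hd hf)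
      eq_h := fun j x y => by
        obtain ⟨a, ha⟩ := gradient_affine (hhaff j)
        rw [(ha x).1.gradient]
        exact (ha x).2 y
      g_le := fun i => (hgconc i).le_inner_gradient (hd (hg i)) }

theorem Regular.exists_isMinOn (hP : P.Regular μ) (hne : P.feasible.Nonempty)
    (hbd : Bornology.IsBounded P.feasible) : ∃ xs ∈ P.feasible, IsMinOn P.f P.feasible xs := by
  have hclosed : IsClosed P.feasible := by
    simp only [feasible, Set.ofPred_and, Set.ofPred_forall]
    exact (isClosed_iInter fun i => isClosed_le continuous_const (hP.continuous_g i)).inter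
      (isClosed_iInter fun j => isClosed_eq (hP.continuous_h j) continuous_const)
  exact (Metric.isCompact_of_isClosed_isBounded hclosed hbd).exists_isMinOn hne
    hP.continuous_f.continuousOn

/-- For affine constraints, the Lagrangian and the objective have the same smoothness constants. -/
theorem Regular.smoothWith_lagrangian_iff_of_affine (hP : P.Regular μ)
    (hhaff : ∀ j, ∃ A : Euc n →ᵃ[ℝ] ℝ, ∀ x, P.h j x = A x)
    (hgaff : ∀ i, ∃ A : Euc n →ᵃ[ℝ] ℝ, ∀ x, P.g i x = A x) (m : Mult nh ng) :
    SmoothWith L (fun y => P.lagrangian y m) ↔ SmoothWith L P.f := by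
  have hconst : ∀ x y, P.conGrad x m = P.conGrad y m := fun x y => by
    choose a ha using fun j => gradient_affine (hhaff j)
    choose b hb using fun i => gradient_affine (hgaff i)
    simp only [conGrad, fun j x => (ha j x).1.gradient, fun i x => (hb i x).1.gradient]
  rw [hP.smoothWith_lagrangian_iff]
  refine forall_congr' fun x => forall_congr' fun y => ?_
  rw [hconst x y, sub_sub_sub_cancel_right]

end Problem

theorem proposition2 {n nh ng : ℕ} (hn : 0 < n) (P : Problem n nh ng)
    -- standing assumptions on the problem
    (hf : LipGrad P.f) (hh : ∀ j, LipGrad (P.h j)) (hg : ∀ i, LipGrad (P.g i))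
    (hne : P.feasible.Nonempty) (hbd : Bornology.IsBounded P.feasible)
    (hMF : ∀ x, P.MFCQ x)
    -- convexity: `h` affine, `g` concave, `f` strongly convex with constant `μ`
    (hhaff : ∀ j, ∃ A : Euc n →ᵃ[ℝ] ℝ, ∀ x, P.h j x = A x)
    (hgconc : ∀ i, ConcaveOn ℝ Set.univ (P.g i))
    (μ : ℝ) (hμ : StrongConvexOn Set.univ μ P.f)
    -- parameters
    (α T L : ℝ) (hα : 0 < α) (hαμ : α < μ) (hT : 0 < T) (hTL : T ≤ 2 / (L + μ))
    -- `lam x` is any one of the dual maximizers at `x`, if there is one, and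
    -- `l(·, lam x)` is smooth with constant `L`
    (lam : Euc n → Mult nh ng)
    (hlam : ∀ x, (∃ m, P.IsDualMaximizer α x m) → P.IsDualMaximizer α x (lam x))
    (hL : ∀ x, SmoothWith L (fun y => P.lagrangian y (lam x))) :
    -- the velocity is well defined, and the maximum in the definition of `d` is attained
    (∀ x, ∃! v, P.IsVelocity α x v) ∧
    (∀ x, P.IsDualMaximizer α x (lam x)) ∧
    -- if `g` is affine, then `l(·, m)` and `f` have the same smoothness constants
    ((∀ i, ∃ A : Euc n →ᵃ[ℝ] ℝ, ∀ x, P.g i x = A x) →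
      ∀ (L' : ℝ) (m : Mult nh ng),
        SmoothWith L' (fun y => P.lagrangian y m) ↔ SmoothWith L' P.f) ∧
    -- the iterates are well defined and unique for every initial point
    (∀ x₀, ∃! p : (ℕ → Euc n) × (ℕ → Euc n), p.1 0 = x₀ ∧ P.IsRun α T p.1 p.2) ∧
    0 < cOne μ α T ∧ 0 < cTwo μ α T L ∧ cTwo μ α T L * T < 1 ∧
    -- there is a unique minimizer `xs`
    ∃ xs : Euc n, (xs ∈ P.feasible ∧ IsMinOn P.f P.feasible xs) ∧
      (∀ y ∈ P.feasible, IsMinOn P.f P.feasible y → y = xs) ∧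
      ∀ x R : ℕ → Euc n, P.IsRun α T x R →
        -- the increment is the projected velocity `-∇f(x_k) + R_k`
        (∀ k, (1 / T) • (x (k + 1) - x k) = -gradient P.f (x k) + R k ∧
          P.IsVelocity α (x k) ((1 / T) • (x (k + 1) - x k))) ∧
        -- convergence of the iterates, of `d`, and of the velocity
        Tendsto x atTop (𝓝 xs) ∧
        Monotone (fun k => P.d α (x k)) ∧
        Tendsto (fun k => P.d α (x k)) atTop (𝓝 (P.f xs)) ∧
        Tendsto (fun k => (1 / T) • (x (k + 1) - x k)) atTop (𝓝 0) ∧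
        -- `O(1/k)` bound for the velocity
        (∀ k : ℕ, (Finset.range (k + 1)).inf' Finset.nonempty_range_add_one
            (fun j => ‖-gradient P.f (x j) + R j‖ ^ 2) ≤
          (P.f xs - P.d α (x 0)) / (cOne μ α T * (k + 1))) ∧
        ∃ N : ℕ, ∀ k ≥ N,
          -- eventual linear rate for the velocity
          ‖-gradient P.f (x k) + R k‖ ^ 2 ≤
            2 / cOne μ α T * (1 - cTwo μ α T L * T) ^ (k - N) * (P.f xs - P.d α (x N)) ∧
          -- `O(1/k)` bound for the iterates
          (Finset.range (k + 1)).inf' Finset.nonempty_range_add_one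
              (fun j => ‖xs - x j‖ ^ 2) ≤
            (L / α - 1) / (cOne μ α T * α * (μ - α)) * ((P.f xs - P.d α (x 0)) / (k + 1)) ∧
          -- eventual linear rate for the iterates
          ‖xs - x k‖ ^ 2 ≤
            2 * (L / α - 1) / (cOne μ α T * α * (μ - α)) *
              (1 - cTwo μ α T L * T) ^ (k - N) * (P.f xs - P.d α (x N)) := by
  have : Nontrivial (Euc n) := by
    have : Nonempty (Fin n) := ⟨⟨0, hn⟩⟩
    infer_instance
  have hP : P.Regular μ := Problem.regular_of_convex hf hh hg hMF hhaff hgconc hμ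
  have hmax : ∀ x, P.IsDualMaximizer α x (lam x) :=
    fun x => hlam x (hP.exists_isDualMaximizer hα x)
  -- One Lagrangian that is both `μ`-strongly convex and `L`-smooth suffices here; `n ≥ 1` provides
  -- two distinct points. It also makes `L + μ` positive.
  have hμL : μ ≤ L := strong_convexity_const_le (hP.lagrangian_le (hmax 0).1.1)
    ((hP.smoothWith_lagrangian_iff _).1 (hL 0))
  have hTL' : T * (L + μ) ≤ 2 := (le_div_iff₀ (by linarith)).1 hTL
  have S : P.Setup μ α T L lam := ⟨hP, hα, hαμ, hT, hμL, hTL', hmax, hL⟩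
  obtain ⟨xs, hxs, hmin⟩ := hP.exists_isMinOn hne hbd
  refine ⟨fun x => ⟨P.vel lam x, (S.velocityVI x).isVelocity,
      fun u hu => (S.velocityVI x).eq_of_isVelocity hu⟩, hmax,
    fun hgaff L' m => hP.smoothWith_lagrangian_iff_of_affine hhaff hgaff m, S.existsUnique_run,
    S.cOne_pos, S.cTwo_pos, S.cTwo_mul_lt_one, xs, ⟨hxs, hmin⟩, fun y hy hymin => ?_,
    fun x R hrun => ?_⟩
  -- Uniqueness of the minimizer: a single run converges to every minimizer, and limits are unique.
  · obtain ⟨⟨x, R⟩, ⟨-, hrun⟩, -⟩ := S.existsUnique_run 0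
    have hx := (S.isRun_iff.1 hrun).1
    exact tendsto_nhds_unique (S.tendsto_iterates hx hy hymin) (S.tendsto_iterates hx hxs hmin)
  · obtain ⟨hx, hR⟩ := S.isRun_iff.1 hrun
    have hinc : ∀ k, (1 / T) • (x (k + 1) - x k) = P.vel lam (x k) := fun k => by
      rw [hx, add_sub_cancel_left, smul_smul, one_div_mul_cancel hT.ne', one_smul]
    have hRv : ∀ k, -gradient P.f (x k) + R k = P.vel lam (x k) := fun k => by
      rw [hR]
      abel
    simp only [hinc, hRv]
    exact ⟨fun k => ⟨trivial, (S.velocityVI _).isVelocity⟩, S.tendsto_iterates hx hxs hmin,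
      S.monotone_d hx, S.tendsto_d hx hxs hmin, S.tendsto_vel hx hne,
      S.inf_norm_vel_sq_le hx hxs, S.exists_rates hx hxs hmin⟩
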